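/- For $n\ge 0$ let $g_2(n;2)$ be the number of $2$-regular bipartite multigraphs on two linearly ordered (labelled) colour classes $u_1\prec\dots\prec u_n$ and $v_1\prec\dots\prec v_n$ all of whose planar matchings have at most $2$ edges. Here a planar matching is a set of edges any two distinct members $uv$, $u'v'$ of which are noncrossing, i.e. $u\prec u'$ and $v\prec v'$, or $u'\prec u$ and $v'\prec v$. All series below are formal power series in $x$ over $\mathbb{Q}$ whose coefficients are polynomials in the other variables; $I_0(2x\sqrt w)=\sum_{s\ge0}\frac{w^s}{s!^2}x^{2s}$. The symbol $\partial t$ denotes the partial derivative with respect to $t$, $\partial^{-1}t$ denotes the primitive with respect to $t$ that vanishes at $t=0$, and powers denote iteration. Let $$\Delta=\begin{vmatrix} I_0\left(2x\sqrt{y_+^{1/2}y_-^{1/2}a_1b_1}\right) & x\,y_-^{1/2}\,\partial^{-1}b_1\, I_0\left(2x\sqrt{y_+^{1/2}y_-^{1/2}a_1b_1}\right)\\[4pt] x\,y_+^{1/2}\,\partial^{-1}a_2\, I_0\left(2x\sqrt{y_+^{1/2}y_-^{1/2}a_2b_2}\right) & I_0\left(2x\sqrt{y_+^{1/2}y_-^{1/2}a_2b_2}\right)\end{vmatrix},$$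 a power series in $x$ with coefficients polynomials in $y_+^{1/2},y_-^{1/2},a_1,b_1,a_2,b_2$, and let $E(\Delta)$ be the series obtained from $\Delta$ by keeping only those monomials in which the exponents of $y_+$ and of $y_-$ are both integers. For a power series $f$ in $x$ with coefficients polynomials in $y_+,y_-,a_1,b_1,a_2,b_2$ let $$\mathcal D(f)=\sum_{k,l\ge0}\frac{(-1)^{k+l}}{k!\,l!}\left(\partial^{-2k}z_+\,\partial^{-2l}z_-\left(\left(\partial^{k}y_+\,\partial^{l}y_-\left(\partial^{k}a_1\,\partial^{l}b_1\,\partial^{k}a_2\,\partial^{l}b_2\, f\right)\Big|_{a_1=b_1=a_2=b_2=1}\right)\Big|_{y_+=z_+^2,\;y_-=z_-^2}\right)\right)\Big|_{z_+=z_-=1},$$ where all operations act on the coefficients of the powers of $x$ (for each such coefficient the sum has only finitely many nonzero terms). Then $$\sum_{n\ge0}\frac{g_2(n;2)}{(2n)!^2}\,x^{4n}=\mathcal D\left(E(\Delta)\right).$$ -/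

import Mathlib

open scoped PowerSeries

namespace PlanarMatching

/-! ## Bipartite multigraphs and planar matchings

A bipartite multigraph on two totally ordered colour classes with `n` vertices each is given by
its multiplicity matrix `M`: there are `M u v` parallel edges between `u` and `v`. -/

/-- Every vertex of either colour class has degree `r`. -/
def IsRegular {n : ℕ} (r : ℕ) (M : Matrix (Fin n) (Fin n) ℕ) : Prop :=
  (∀ u, ∑ v, M u v = r) ∧ (∀ v, ∑ u, M u v = r)

/-- Two edges `e = (u, v)`, `f = (u', v')` are noncrossing if `u, u'` are in the same strict order
as `v, v'`. In particular parallel edges, or edges sharing an endpoint, are not noncrossing. -/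
def Noncrossing {n : ℕ} (e f : Fin n × Fin n) : Prop :=
  (e.1 < f.1 ∧ e.2 < f.2) ∨ (f.1 < e.1 ∧ f.2 < e.2)

/-- A planar matching of `M`: a set of edges of `M`, any two distinct ones being noncrossing.
(As two parallel edges are never noncrossing, it is determined by its set of endpoint pairs.) -/
def IsPlanarMatching {n : ℕ} (M : Matrix (Fin n) (Fin n) ℕ) (S : Finset (Fin n × Fin n)) : Prop :=
  (∀ e ∈ S, 0 < M e.1 e.2) ∧ (∀ e ∈ S, ∀ f ∈ S, e ≠ f → Noncrossing e f)

/-- The set of `r`-regular bipartite multigraphs with `n` vertices in each colour class all of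
whose planar matchings have at most `d` edges. -/
def graphs (r n d : ℕ) : Set (Matrix (Fin n) (Fin n) ℕ) :=
  {M | IsRegular r M ∧ ∀ S, IsPlanarMatching M S → S.card ≤ d}

theorem graphs_finite (r n d : ℕ) : (graphs r n d).Finite := by
  refine (Set.Finite.pi' (fun _ : Fin n => Set.Finite.pi' (fun _ : Fin n =>
    Set.finite_Iic r))).subset ?_
  rintro M ⟨⟨h, -⟩, -⟩ u v
  have := Finset.single_le_sum (f := fun v => M u v) (fun i _ => Nat.zero_le _) (Finset.mem_univ v)
  exact this.trans (h u).le

/-- The number of `r`-regular bipartite multigraphs with `n` vertices in each colour class all of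
whose planar matchings have at most `d` edges. -/
noncomputable def g (r n d : ℕ) : ℕ := (graphs r n d).ncard

/-! ## The formal variables and rings -/

/-- Labels of the two variables `y_+`, `y_-` (and also of `z_+`, `z_-`). -/
inductive Sgn
  | plus
  | minus
  deriving DecidableEq

/-- Labels of the four variables `a₁, b₁, a₂, b₂`. -/
inductive AB
  | a1
  | b1
  | a2
  | b2
  deriving DecidableEq

/-- Polynomials in `y_+^{1/2}, y_-^{1/2}, a₁, b₁, a₂, b₂`;
the variable `Sum.inl ε` stands for `y_ε^{1/2}`. -/
abbrev HalfRing := MvPolynomial (Sgn ⊕ AB) ℚ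

/-- Polynomials in `y_+, y_-, a₁, b₁, a₂, b₂`; the variable `Sum.inl ε` stands for `y_ε`. -/
abbrev YABRing := MvPolynomial (Sgn ⊕ AB) ℚ

/-- Polynomials in `y_+, y_-`. -/
abbrev YRing := MvPolynomial Sgn ℚ

/-- Polynomials in `z_+, z_-`. -/
abbrev ZRing := MvPolynomial Sgn ℚ

/-- A map on coefficients applied to a power series in `x`. -/
noncomputable def coeffwise {A B : Type*} [Semiring A] [Semiring B] (T : A → B) (f : A⟦X⟧) : B⟦X⟧ :=
  PowerSeries.mk fun n => T (PowerSeries.coeff n f)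

/-- The primitive with respect to the variable `i` that vanishes at `i = 0`. -/
noncomputable def primitive {σ : Type*} (i : σ) :
    MvPolynomial σ ℚ →ₗ[ℚ] MvPolynomial σ ℚ :=
  (MvPolynomial.basisMonomials σ ℚ).constr ℚ fun m =>
    MvPolynomial.monomial (m + Finsupp.single i 1) (1 / (m i + 1 : ℚ))

/-- The part of a polynomial in `y_±^{1/2}, a_i, b_i` in which the exponents of both `y_+` and
`y_-` are integers, as a polynomial in `y_±, a_i, b_i`: the monomial
`(y_+^{1/2})^p (y_-^{1/2})^q (…)` goes to `y_+^{p/2} y_-^{q/2} (…)` if `p` and `q` are even, and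
to `0` otherwise. -/
noncomputable def integralPart : HalfRing →ₗ[ℚ] YABRing :=
  (MvPolynomial.basisMonomials (Sgn ⊕ AB) ℚ).constr ℚ fun m =>
    if Even (m (Sum.inl Sgn.plus)) ∧ Even (m (Sum.inl Sgn.minus)) then
      MvPolynomial.monomial
        (Finsupp.sumElim ((Finsupp.comapDomain Sum.inl m Sum.inl_injective.injOn).mapRange
            (fun p => p / 2) (Nat.zero_div 2))
          (Finsupp.comapDomain Sum.inr m Sum.inr_injective.injOn)) 1
    else 0

/-- `|_{a_i = b_i = 1}` -/
noncomputable def setABOne : YABRing →ₐ[ℚ] YRing :=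
  MvPolynomial.aeval (Sum.elim MvPolynomial.X fun _ => 1)

/-- `|_{y_+ = z_+², y_- = z_-²}` -/
noncomputable def setYSq : YRing →ₐ[ℚ] ZRing :=
  MvPolynomial.aeval fun ε => MvPolynomial.X ε ^ 2

/-- `|_{z_+ = z_- = 1}` -/
noncomputable def setZOne : ZRing →ₐ[ℚ] ℚ :=
  MvPolynomial.aeval fun _ => 1

/-- The operator `∂^k_{a₁} ∂^l_{b₁} ∂^k_{a₂} ∂^l_{b₂}`. -/
noncomputable def diffAB (k l : ℕ) (f : YABRing) : YABRing :=
  (MvPolynomial.pderiv (Sum.inr AB.a1))^[k] ((MvPolynomial.pderiv (Sum.inr AB.b1))^[l]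
    ((MvPolynomial.pderiv (Sum.inr AB.a2))^[k] ((MvPolynomial.pderiv (Sum.inr AB.b2))^[l] f)))

/-- The operator `∂^k_{y_+} ∂^l_{y_-}`. -/
noncomputable def diffY (k l : ℕ) (f : YRing) : YRing :=
  (MvPolynomial.pderiv Sgn.plus)^[k] ((MvPolynomial.pderiv Sgn.minus)^[l] f)

/-- The operator `∂^{-2k}_{z_+} ∂^{-2l}_{z_-}`. -/
noncomputable def primZ (k l : ℕ) (f : ZRing) : ZRing :=
  (primitive Sgn.plus)^[2 * k] ((primitive Sgn.minus)^[2 * l] f)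

/-- The `(k, l)` term of the operator `𝒟`, on polynomials in `y_±, a_i, b_i`. -/
noncomputable def Dterm (k l : ℕ) (f : YABRing) : ℚ :=
  ((-1) ^ (k + l) / (k.factorial * l.factorial : ℚ)) *
    setZOne (primZ k l (setYSq (diffY k l (setABOne (diffAB k l f)))))

/-- The operator `𝒟` on polynomials in `y_±, a_i, b_i`: the sum of its `(k, l)` terms over all
`k, l ≥ 0`, of which only finitely many are nonzero (see `Dterm_support_finite`). -/
noncomputable def Dpoly (f : YABRing) : ℚ := ∑ᶠ kl : ℕ × ℕ, Dterm kl.1 kl.2 f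

/-- The operator `𝒟` on power series in `x` with coefficients polynomials in `y_±, a_i, b_i`. -/
noncomputable def D : YABRing⟦X⟧ → ℚ⟦X⟧ := coeffwise Dpoly

theorem pderiv_iterate_eq_zero {σ : Type*} (i : σ) (f : MvPolynomial σ ℚ) (k : ℕ)
    (hk : f.totalDegree < k) : (MvPolynomial.pderiv i)^[k] f = 0 := by
  have key : ∀ (k : ℕ) (m : σ →₀ ℕ) (c : ℚ), m i < k →
      (MvPolynomial.pderiv i)^[k] (MvPolynomial.monomial m c) = 0 := by
    intro k
    induction k with
    | zero => intro m c h; omega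
    | succ k ih =>
      intro m c h
      rw [Function.iterate_succ_apply, MvPolynomial.pderiv_monomial]
      rcases Nat.eq_zero_or_pos (m i) with h0 | h0
      · simp [h0]
      · apply ih
        simp
        omega
  have hlin : ∀ p : MvPolynomial σ ℚ, (MvPolynomial.pderiv i)^[k] p =
      ((MvPolynomial.pderiv (R := ℚ) i).toLinearMap ^ k) p := by
    intro p
    rw [Module.End.pow_apply]
    rfl
  rw [hlin, f.as_sum, map_sum]
  refine Finset.sum_eq_zero fun m hm => ?_
  rw [← hlin]
  refine key k m _ (lt_of_le_of_lt ?_ hk)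
  refine le_trans ?_ (MvPolynomial.le_totalDegree hm)
  by_cases hi : m i = 0
  · simp [hi]
  · exact Finset.single_le_sum (f := fun j => m j) (fun _ _ => Nat.zero_le _)
      (Finsupp.mem_support_iff.mpr hi)

theorem pderiv_iterate_comm {σ : Type*} (i j : σ) (k l : ℕ) (f : MvPolynomial σ ℚ) :
    (MvPolynomial.pderiv i)^[k] ((MvPolynomial.pderiv j)^[l] f) =
      (MvPolynomial.pderiv j)^[l] ((MvPolynomial.pderiv i)^[k] f) := by
  have h : Function.Commute (MvPolynomial.pderiv (R := ℚ) i) (MvPolynomial.pderiv j) := by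
    intro p
    have h0 : ⁅MvPolynomial.pderiv (R := ℚ) i, MvPolynomial.pderiv (R := ℚ) j⁆ = 0 := by
      apply MvPolynomial.derivation_ext
      intro n
      classical
      simp [Derivation.commutator_apply, MvPolynomial.pderiv_X, Pi.single_apply, apply_ite]
    have := congrArg (fun d => d p) h0
    simpa [Derivation.commutator_apply, sub_eq_zero] using this
  exact (h.iterate_iterate k l) f

/-- The sum defining `𝒟` on a polynomial is finite. -/
theorem Dterm_support_finite (f : YABRing) :
    (Function.support fun kl : ℕ × ℕ => Dterm kl.1 kl.2 f).Finite := by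
  have hz : ∀ (i : Sgn ⊕ AB) (k : ℕ), (MvPolynomial.pderiv (R := ℚ) i)^[k] 0 = 0 := fun i k =>
    Function.iterate_fixed (map_zero (MvPolynomial.pderiv (R := ℚ) i)) k
  have hy : ∀ (i : Sgn) (k : ℕ), (MvPolynomial.pderiv (R := ℚ) i)^[k] 0 = 0 := fun i k =>
    Function.iterate_fixed (map_zero (MvPolynomial.pderiv (R := ℚ) i)) k
  have hp : ∀ (i : Sgn) (k : ℕ), (primitive i)^[k] 0 = 0 := fun i k =>
    Function.iterate_fixed (map_zero (primitive i)) k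
  have h0 : ∀ k l, diffAB k l f = 0 → Dterm k l f = 0 := by
    intro k l h
    simp [Dterm, h, diffY, primZ, hy, hp]
  refine ((Set.finite_Iic f.totalDegree).prod (Set.finite_Iic f.totalDegree)).subset ?_
  rintro ⟨k, l⟩ hkl
  by_contra hn
  apply hkl
  simp only [Set.mem_prod, Set.mem_Iic, not_and_or, not_le] at hn
  apply h0
  rcases hn with hn | hn
  · rw [diffAB, pderiv_iterate_comm (Sum.inr AB.a2), pderiv_iterate_eq_zero _ f k hn]
    simp [hz]
  · rw [diffAB, pderiv_iterate_eq_zero _ f l hn]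
    simp [hz]

/-! ## The determinant -/

/-- The Bessel series `I_0(t) = ∑_m (t/2)^{2m} / (m! Γ(m+1))` as a formal power series in `t`. -/
noncomputable def besselI0 : ℚ⟦X⟧ :=
  PowerSeries.mk fun N => if Even N then
    (1 / 2 : ℚ) ^ N / ((N / 2).factorial * (N / 2).factorial) else 0

/-- `I_0(2 x √w) = ∑_m w^m x^{2m} / m!²` as a power series in `x`, for `w` in a `ℚ`-algebra.
Only `w`, and not a square root of it, enters. -/
noncomputable def besselI0Sqrt {A : Type*} [CommRing A] [Algebra ℚ A] (w : A) : A⟦X⟧ :=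
  PowerSeries.mk fun N => if Even N then
    (1 / ((N / 2).factorial * (N / 2).factorial) : ℚ) • w ^ (N / 2) else 0

/-- If `w` has a square root `ρ`, then `besselI0Sqrt w` is the series `I_0(t)` at `t = 2 x ρ`. -/
theorem besselI0Sqrt_sq {A : Type*} [CommRing A] [Algebra ℚ A] (ρ : A) :
    besselI0Sqrt (ρ ^ 2) =
      PowerSeries.rescale (2 * ρ) (PowerSeries.map (algebraMap ℚ A) besselI0) := by
  ext N
  simp only [besselI0Sqrt, besselI0, PowerSeries.coeff_mk, PowerSeries.coeff_rescale,
    PowerSeries.coeff_map]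
  split_ifs with h
  · obtain ⟨m, rfl⟩ := h
    have h2 : (2 : A) = algebraMap ℚ A 2 := (map_ofNat (algebraMap ℚ A) 2).symm
    rw [Algebra.smul_def, mul_pow, h2, ← map_pow, mul_right_comm, ← map_mul]
    have e : (m + m) / 2 = m := by omega
    have e1 : (2 : ℚ) ^ (m + m) * ((1 / 2) ^ (m + m) / (m.factorial * m.factorial)) =
        1 / (m.factorial * m.factorial) := by
      rw [← mul_div_assoc, ← mul_pow]; norm_num
    rw [e, e1, ← pow_mul, two_mul]
  · simp

/-- `y_ε^{1/2}` -/
noncomputable def sqrtY (ε : Sgn) : HalfRing := MvPolynomial.X (Sum.inl ε)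

/-- One of the variables `a₁, b₁, a₂, b₂`. -/
noncomputable def ab (i : AB) : HalfRing := MvPolynomial.X (Sum.inr i)

/-- `I_0(2 x √(y_+^{1/2} y_-^{1/2} a b))` -/
noncomputable def entryI0 (a b : AB) : HalfRing⟦X⟧ :=
  besselI0Sqrt (sqrtY Sgn.plus * sqrtY Sgn.minus * ab a * ab b)

/-- The primitive with respect to one of `a₁, b₁, a₂, b₂` of a power series in `x`. -/
noncomputable def primAB (i : AB) : HalfRing⟦X⟧ → HalfRing⟦X⟧ :=
  coeffwise (primitive (Sum.inr i))

/-- The `2 × 2` matrix with diagonal entries `I_0(2 x √(y_+^{1/2} y_-^{1/2} a_i b_i))`, `i = 1, 2`,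
and off-diagonal entries `x y_-^{1/2} ∂^{-1}_{b₁} I_0(2 x √(y_+^{1/2} y_-^{1/2} a₁ b₁))` and
`x y_+^{1/2} ∂^{-1}_{a₂} I_0(2 x √(y_+^{1/2} y_-^{1/2} a₂ b₂))`. -/
noncomputable def besselMatrix : Matrix (Fin 2) (Fin 2) HalfRing⟦X⟧ :=
  !![entryI0 AB.a1 AB.b1,
      PowerSeries.X * PowerSeries.C (sqrtY Sgn.minus) * primAB AB.b1 (entryI0 AB.a1 AB.b1);
    PowerSeries.X * PowerSeries.C (sqrtY Sgn.plus) * primAB AB.a2 (entryI0 AB.a2 AB.b2),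
      entryI0 AB.a2 AB.b2]

end PlanarMatching

/-!
Reversing the order of the second colour class turns the graphs into the `n × n` matrices of natural
numbers with all row and column sums `2` and without three positive entries in strictly descending
position. Both sides of the identity are expressed by trinomial coefficients: the coefficient of
`x ^ (4 * n)`, multiplied by `(2 * n)! ^ 2`, is `T 0 - T 1`, where `T k` is the coefficient of
`z ^ k` in `(z⁻¹ + 1 + z) ^ (2 * n)`.

*The graphs.* Read such a matrix along its diagonal. At time `i` record the diagonal entry `M i i`,
the sum of column `i` above it and the sum of row `i` to its left. As rows and columns have equal
sums, the total `h i` of the entries with `r < i ≤ c` equals that of the entries with `c < i ≤ r`.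
Hence two strictly descending entries above the diagonal would be completed to three by an entry
below it, and so the part above the diagonal has no strict descent (`upper_descentFree`). A matrix
without strict descents is determined by its margins, by the north-west corner rule
(`DescentFree.ext`), and it consists of the overlaps of two families of consecutive intervals with
these margins as lengths (`overlap`). So the matrices correspond to the walks `h` on `ℕ` with
certain admissible steps (`ncard_triFree`). One such step amounts to two steps in `{-1, 0, 1}` on
`ℕ`, where the step `0` is forbidden at height `0`, and the reflection principle counts these walks
(`card_walks`, `g_two_two`).

*The determinant.* The coefficients of the determinant are explicit sums of monomials, and `𝒟` maps
a monomial to a product of two alternating sums, one for each sign (`Dpoly_monomial`). Each of them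
is a coefficient of `((1 + X) ^ 2 - X) ^ n = (1 + X + X ^ 2) ^ n`, up to factorials that cancel
(`derivSum_eq`). What remains are the sums of `B s * B s` and of `B s * B (s + 1)`, where `B s` are
the coefficients of the palindromic polynomial `(1 + X + X ^ 2) ^ n`. These convolutions are
coefficients of its square (`sum_trinomial_sq`, `sum_trinomial_mul_succ`).
-/

namespace PlanarMatching

/-! ### Matrices without strict descents -/

/-- A matrix has a strict descent if it has positive entries in two positions, one strictly to the
north-east of the other. This predicate says that there are none. -/
def DescentFree (U : ℕ → ℕ → ℕ) : Prop :=
  ∀ r c r' c', r < r' → c' < c → 0 < U r c → 0 < U r' c' → False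

/-- In a descent-free matrix the block north-east of a corner or the block south-west of it
vanishes, so the north-west block carries all that the margins allow. -/
theorem DescentFree.sum_block {U : ℕ → ℕ → ℕ} (h : DescentFree U) {n i j : ℕ}
    (hi : i ≤ n) (hj : j ≤ n) :
    ∑ r ∈ Finset.range i, ∑ c ∈ Finset.range j, U r c =
      min (∑ r ∈ Finset.range i, ∑ c ∈ Finset.range n, U r c)
        (∑ c ∈ Finset.range j, ∑ r ∈ Finset.range n, U r c) := by
  have e1 : ∑ r ∈ Finset.range i, ∑ c ∈ Finset.range n, U r c =
      ∑ r ∈ Finset.range i, ∑ c ∈ Finset.range j, U r c +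
        ∑ r ∈ Finset.range i, ∑ c ∈ Finset.Ico j n, U r c := by
    rw [← Finset.sum_add_distrib]
    exact Finset.sum_congr rfl fun r _ => (Finset.sum_range_add_sum_Ico _ hj).symm
  have e2 : ∑ c ∈ Finset.range j, ∑ r ∈ Finset.range n, U r c =
      ∑ r ∈ Finset.range i, ∑ c ∈ Finset.range j, U r c +
        ∑ c ∈ Finset.range j, ∑ r ∈ Finset.Ico i n, U r c := by
    rw [Finset.sum_comm (s := Finset.range i), ← Finset.sum_add_distrib]
    exact Finset.sum_congr rfl fun r _ => (Finset.sum_range_add_sum_Ico _ hi).symm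
  have key : ∑ r ∈ Finset.range i, ∑ c ∈ Finset.Ico j n, U r c = 0 ∨
      ∑ c ∈ Finset.range j, ∑ r ∈ Finset.Ico i n, U r c = 0 := by
    by_contra! hne
    obtain ⟨r, hr, h1⟩ := Finset.exists_ne_zero_of_sum_ne_zero hne.1
    obtain ⟨c, hc, h1⟩ := Finset.exists_ne_zero_of_sum_ne_zero h1
    obtain ⟨c', hc', h2⟩ := Finset.exists_ne_zero_of_sum_ne_zero hne.2
    obtain ⟨r', hr', h2⟩ := Finset.exists_ne_zero_of_sum_ne_zero h2
    simp only [Finset.mem_range, Finset.mem_Ico] at hr hc hr' hc'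
    exact h r c r' c' (by omega) (by omega) (by omega) (by omega)
  omega

/-- A descent-free matrix is determined by its row and column sums. -/
theorem DescentFree.ext {U V : ℕ → ℕ → ℕ} (hU : DescentFree U) (hV : DescentFree V) {n : ℕ}
    (hrow : ∀ r < n, ∑ c ∈ Finset.range n, U r c = ∑ c ∈ Finset.range n, V r c)
    (hcol : ∀ c < n, ∑ r ∈ Finset.range n, U r c = ∑ r ∈ Finset.range n, V r c)
    {r c : ℕ} (hr : r < n) (hc : c < n) : U r c = V r c := by
  have block : ∀ i j, i ≤ n → j ≤ n → ∑ r ∈ Finset.range i, ∑ c ∈ Finset.range j, U r c =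
      ∑ r ∈ Finset.range i, ∑ c ∈ Finset.range j, V r c := by
    intro i j hi hj
    rw [hU.sum_block hi hj, hV.sum_block hi hj]
    congr 1
    · exact Finset.sum_congr rfl fun r hr => hrow r ((Finset.mem_range.1 hr).trans_le hi)
    · exact Finset.sum_congr rfl fun c hc => hcol c ((Finset.mem_range.1 hc).trans_le hj)
  have row : ∀ j, j ≤ n → ∑ c ∈ Finset.range j, U r c = ∑ c ∈ Finset.range j, V r c := by
    intro j hj
    have h1 := block (r + 1) j hr hj
    rw [Finset.sum_range_succ, Finset.sum_range_succ, block r j hr.le hj] at h1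
    omega
  have h2 := row (c + 1) hc
  rw [Finset.sum_range_succ, Finset.sum_range_succ, row c hc.le] at h2
  omega

/-- The length of the overlap of the `r`-th interval `[P r, P (r + 1))` and the `c`-th interval
`[A c, A (c + 1))`: the descent-free matrix whose margins have partial sums `P` and `A`. Truncated
subtraction makes it `0` for disjoint intervals. -/
def overlap (P A : ℕ → ℕ) (r c : ℕ) : ℕ := min (P (r + 1)) (A (c + 1)) - max (P r) (A c)

theorem overlap_comm (P A : ℕ → ℕ) (r c : ℕ) : overlap P A r c = overlap A P c r := by
  unfold overlap; omega

theorem overlap_descentFree {P A : ℕ → ℕ} (hP : Monotone P) (hA : Monotone A) :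
    DescentFree (overlap P A) := by
  intro r c r' c' hr hc h1 h2
  have := hP (show r + 1 ≤ r' from hr)
  have := hA (show c' + 1 ≤ c from hc)
  unfold overlap at h1 h2
  omega

theorem sum_overlap {P A : ℕ → ℕ} (hP : Monotone P) (hA : Monotone A) (h0 : P 0 = 0) (c R : ℕ) :
    ∑ r ∈ Finset.range R, overlap P A r c + min (P R) (A c) = min (P R) (A (c + 1)) := by
  have h2 := hA (Nat.le_succ c)
  induction R with
  | zero => simp [h0]
  | succ R ih =>
    have h1 := hP (Nat.le_succ R)
    rw [Finset.sum_range_succ]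
    simp only [Nat.succ_eq_add_one] at h1 h2
    unfold overlap at ih ⊢
    omega

/-! ### The walk of a matrix -/

/-- The `n × n` matrices of natural numbers, extended by zero to `ℕ × ℕ`, all of whose row and
column sums are `2` and which have no three positive entries in strictly descending position. -/
def triFree (n : ℕ) : Set (ℕ → ℕ → ℕ) :=
  {M | (∀ r c, M r c ≠ 0 → r < n ∧ c < n) ∧
    (∀ r < n, ∑ c ∈ Finset.range n, M r c = 2) ∧
    (∀ c < n, ∑ r ∈ Finset.range n, M r c = 2) ∧
    ∀ r₁ r₂ r₃ c₁ c₂ c₃, r₁ < r₂ → r₂ < r₃ → c₃ < c₂ → c₂ < c₁ →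
      0 < M r₁ c₁ → 0 < M r₂ c₂ → 0 < M r₃ c₃ → False}

theorem triFree_transpose {n : ℕ} {M : ℕ → ℕ → ℕ} (h : M ∈ triFree n) :
    (fun r c => M c r) ∈ triFree n := by
  obtain ⟨h1, h2, h3, h4⟩ := h
  refine ⟨fun r c h => (h1 c r h).symm, h3, h2, ?_⟩
  intro r₁ r₂ r₃ c₁ c₂ c₃ a b c d e f g
  exact h4 c₃ c₂ c₁ r₃ r₂ r₁ c d a b g f e

/-- The part of a matrix strictly above the diagonal. -/
def upper (M : ℕ → ℕ → ℕ) (r c : ℕ) : ℕ := if r < c then M r c else 0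

/-- The `i`-th step of a matrix: its diagonal entry `M i i`, the part of column `i` above the
diagonal, and the part of row `i` left of the diagonal. -/
def toWalk (M : ℕ → ℕ → ℕ) (i : ℕ) : ℕ × ℕ × ℕ :=
  (M i i, ∑ r ∈ Finset.range i, M r i, ∑ c ∈ Finset.range i, M i c)

/-- Exchange of the roles of rows and columns in a walk. -/
def swap (s : ℕ → ℕ × ℕ × ℕ) (i : ℕ) : ℕ × ℕ × ℕ := ((s i).1, (s i).2.2, (s i).2.1)

/-- For the walk of a matrix, the total of the rows before `i` strictly above the diagonal: in row
`k` this is what the row sum `2` leaves beside the diagonal entry and the part left of it. -/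
def opened (s : ℕ → ℕ × ℕ × ℕ) (i : ℕ) : ℕ := ∑ k ∈ Finset.range i, (2 - (s k).1 - (s k).2.2)

/-- For the walk of a matrix, the total of the columns before `i` strictly above the diagonal. -/
def closed (s : ℕ → ℕ × ℕ × ℕ) (i : ℕ) : ℕ := ∑ k ∈ Finset.range i, (s k).2.1

theorem opened_mono (s : ℕ → ℕ × ℕ × ℕ) : Monotone (opened s) :=
  monotone_nat_of_le_succ fun i => by simp [opened, Finset.sum_range_succ]

theorem closed_mono (s : ℕ → ℕ × ℕ × ℕ) : Monotone (closed s) :=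
  monotone_nat_of_le_succ fun i => by simp [closed, Finset.sum_range_succ]

theorem opened_zero (s : ℕ → ℕ × ℕ × ℕ) : opened s 0 = 0 := rfl

theorem closed_zero (s : ℕ → ℕ × ℕ × ℕ) : closed s 0 = 0 := rfl

theorem opened_succ (s : ℕ → ℕ × ℕ × ℕ) (i : ℕ) :
    opened s (i + 1) = opened s i + (2 - (s i).1 - (s i).2.2) := Finset.sum_range_succ _ _

theorem closed_succ (s : ℕ → ℕ × ℕ × ℕ) (i : ℕ) :
    closed s (i + 1) = closed s i + (s i).2.1 := Finset.sum_range_succ _ _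

theorem swap_toWalk (M : ℕ → ℕ → ℕ) : swap (toWalk M) = toWalk fun r c => M c r := rfl

/-- Admissibility of the `i`-th step of a walk. What is closed at time `i` was opened before, and a
nonzero diagonal entry is allowed only if nothing above the diagonal, or nothing below it, passes
time `i`. -/
def StepOK (s : ℕ → ℕ × ℕ × ℕ) (i : ℕ) : Prop :=
  (s i).1 + (s i).2.1 ≤ 2 ∧ (s i).1 + (s i).2.2 ≤ 2 ∧
    closed s (i + 1) ≤ opened s i ∧ closed (swap s) (i + 1) ≤ opened (swap s) i ∧
    ((s i).1 = 0 ∨ closed s (i + 1) = opened s i ∨ closed (swap s) (i + 1) = opened (swap s) i)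

/-- The walks with `n` steps from height `0` to height `h`, where the height at time `i` is
`opened s i - closed s i`. -/
def IsWalk (n h : ℕ) (s : ℕ → ℕ × ℕ × ℕ) : Prop :=
  (∀ i, n ≤ i → s i = 0) ∧ (∀ i < n, StepOK s i) ∧ opened s n = closed s n + h

/-- The height is the same for a walk and its mirror image. -/
theorem opened_add_closed_swap {n : ℕ} {s : ℕ → ℕ × ℕ × ℕ}
    (hs : ∀ i < n, (s i).1 + (s i).2.1 ≤ 2 ∧ (s i).1 + (s i).2.2 ≤ 2) :
    ∀ i ≤ n, opened s i + closed (swap s) i = opened (swap s) i + closed s i := by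
  intro i
  induction i with
  | zero => simp [opened_zero, closed_zero]
  | succ i ih =>
    intro hi
    have := ih (by omega)
    have := hs i hi
    simp only [opened_succ, closed_succ, swap] at *
    omega

theorem sum_upper_col {M : ℕ → ℕ → ℕ} {n c : ℕ} (hc : c < n) :
    ∑ r ∈ Finset.range n, upper M r c = (toWalk M c).2.1 := by
  rw [← Finset.sum_range_add_sum_Ico _ hc.le, Finset.sum_eq_zero (s := Finset.Ico c n), add_zero]
  · refine Finset.sum_congr rfl fun r hr => ?_
    rw [upper, if_pos (Finset.mem_range.1 hr)]
  · intro r hr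
    rw [upper, if_neg (not_lt.2 (Finset.mem_Ico.1 hr).1)]

theorem sum_row_eq {M : ℕ → ℕ → ℕ} {n r : ℕ} (hr : r < n) :
    ∑ c ∈ Finset.range n, M r c =
      (toWalk M r).1 + (toWalk M r).2.2 + ∑ c ∈ Finset.range n, upper M r c := by
  have h1 := Finset.sum_range_add_sum_Ico (M r) (Nat.succ_le_of_lt hr)
  have h2 := Finset.sum_range_add_sum_Ico (upper M r) (Nat.succ_le_of_lt hr)
  have h3 : ∑ c ∈ Finset.Ico (r + 1) n, upper M r c = ∑ c ∈ Finset.Ico (r + 1) n, M r c :=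
    Finset.sum_congr rfl fun c hc => if_pos (Finset.mem_Ico.1 hc).1
  have h4 : ∑ c ∈ Finset.range (r + 1), upper M r c = 0 :=
    Finset.sum_eq_zero fun c hc => if_neg (by have := Finset.mem_range.1 hc; omega)
  simp only [Nat.succ_eq_add_one] at h1 h2
  rw [Finset.sum_range_succ] at h1
  simp only [toWalk]
  omega

theorem sum_upper_row {n : ℕ} {M : ℕ → ℕ → ℕ} (hM : M ∈ triFree n) {r : ℕ} (hr : r < n) :
    ∑ c ∈ Finset.range n, upper M r c = 2 - (toWalk M r).1 - (toWalk M r).2.2 := by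
  have h1 := sum_row_eq (M := M) hr
  have h2 := hM.2.1 r hr
  omega

theorem toWalk_add_le {n : ℕ} {M : ℕ → ℕ → ℕ} (hM : M ∈ triFree n) {i : ℕ} (hi : i < n) :
    (toWalk M i).1 + (toWalk M i).2.1 ≤ 2 ∧ (toWalk M i).1 + (toWalk M i).2.2 ≤ 2 := by
  have h1 := sum_row_eq (M := M) hi
  have h2 := hM.2.1 i hi
  have h3 := sum_row_eq (M := fun r c => M c r) hi
  have h4 := hM.2.2.1 i hi
  simp only [toWalk] at *
  omega

/-- What is opened before `i` and not closed before `e ∈ {i, i + 1}` is the total of the entries in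
the rows before `i` and the columns from `e` on. -/
theorem opened_toWalk {n : ℕ} {M : ℕ → ℕ → ℕ} (hM : M ∈ triFree n) {i e : ℕ} (hie : i ≤ e)
    (hei : e ≤ i + 1) (he : e ≤ n) :
    opened (toWalk M) i = closed (toWalk M) e +
      ∑ r ∈ Finset.range i, ∑ c ∈ Finset.Ico e n, M r c := by
  have h1 : opened (toWalk M) i = ∑ r ∈ Finset.range i, ∑ c ∈ Finset.range n, upper M r c :=
    Finset.sum_congr rfl fun r hr =>
      (sum_upper_row hM ((Finset.mem_range.1 hr).trans_le (hie.trans he))).symm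
  have h2 : closed (toWalk M) e = ∑ r ∈ Finset.range i, ∑ c ∈ Finset.range e, upper M r c := by
    rw [Finset.sum_comm]
    refine Finset.sum_congr rfl fun c hc => ?_
    have hc := Finset.mem_range.1 hc
    rw [← sum_upper_col (hc.trans_le he), ← Finset.sum_range_add_sum_Ico _ (hie.trans he),
      Finset.sum_eq_zero (s := Finset.Ico i n), add_zero]
    intro r hr
    have := Finset.mem_Ico.1 hr
    exact if_neg (by omega)
  rw [h1, h2, ← Finset.sum_add_distrib]
  refine Finset.sum_congr rfl fun r hr => ?_
  rw [← Finset.sum_range_add_sum_Ico _ he]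
  congr 1
  refine Finset.sum_congr rfl fun c hc => ?_
  have := Finset.mem_Ico.1 hc
  have := Finset.mem_range.1 hr
  exact if_pos (by omega)

/-- Two descending entries above the diagonal leave, by equality of the heights above and below
the diagonal, room for a third descending entry below it. -/
theorem upper_descentFree {n : ℕ} {M : ℕ → ℕ → ℕ} (hM : M ∈ triFree n) :
    DescentFree (upper M) := by
  intro r c r' c' hr hc h1 h2
  have d1 : r < c ∧ 0 < M r c := by unfold upper at h1; split_ifs at h1 <;> omega
  have d2 : r' < c' ∧ 0 < M r' c' := by unfold upper at h2; split_ifs at h2 <;> omega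
  have hcn := (hM.1 r c (by omega)).2
  have e1 := opened_toWalk hM (le_refl c') (by omega) (by omega)
  have e2 := opened_toWalk (triFree_transpose hM) (le_refl c') (by omega) (by omega)
  have e3 := opened_add_closed_swap (s := toWalk M) (fun i hi => toWalk_add_le hM hi) c'
    (show c' ≤ n by omega)
  rw [swap_toWalk] at e3
  have pos : 0 < ∑ r ∈ Finset.range c', ∑ c ∈ Finset.Ico c' n, M r c := by
    refine Finset.sum_pos' (fun _ _ => Nat.zero_le _) ⟨r', Finset.mem_range.2 d2.1, ?_⟩
    exact Finset.sum_pos' (fun _ _ => Nat.zero_le _)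
      ⟨c', Finset.mem_Ico.2 ⟨le_rfl, by omega⟩, d2.2⟩
  obtain ⟨c'', hc'', h3⟩ := Finset.exists_ne_zero_of_sum_ne_zero
    (show ∑ c ∈ Finset.range c', ∑ r ∈ Finset.Ico c' n, M r c ≠ 0 by omega)
  obtain ⟨r'', hr'', h3⟩ := Finset.exists_ne_zero_of_sum_ne_zero h3
  have := Finset.mem_range.1 hc''
  have := Finset.mem_Ico.1 hr''
  exact hM.2.2.2 r r' r'' c c' c'' hr (by omega) (by omega) hc d1.2 d2.2 (by omega)

theorem toWalk_isWalk {n : ℕ} {M : ℕ → ℕ → ℕ} (hM : M ∈ triFree n) : IsWalk n 0 (toWalk M) := by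
  refine ⟨fun i hi => ?_, fun i hi => ?_, ?_⟩
  · have z : ∀ r c, n ≤ r ∨ n ≤ c → M r c = 0 := by
      intro r c h
      by_contra h'
      have := hM.1 r c h'
      omega
    have z1 : ∑ r ∈ Finset.range i, M r i = 0 := Finset.sum_eq_zero fun r _ => z r i (Or.inr hi)
    have z2 : ∑ c ∈ Finset.range i, M i c = 0 := Finset.sum_eq_zero fun c _ => z i c (Or.inl hi)
    simp only [toWalk, z i i (Or.inl hi), z1, z2]
    rfl
  · have e1 := opened_toWalk hM (Nat.le_succ i) le_rfl hi
    have e2 := opened_toWalk (triFree_transpose hM) (Nat.le_succ i) le_rfl hi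
    simp only [Nat.succ_eq_add_one] at e1 e2
    refine ⟨(toWalk_add_le hM hi).1, (toWalk_add_le hM hi).2, by omega, ?_, ?_⟩
    · rw [swap_toWalk]
      omega
    · rw [swap_toWalk]
      by_contra! hne
      obtain ⟨h0, h1, h2⟩ := hne
      obtain ⟨r, hr, h1⟩ := Finset.exists_ne_zero_of_sum_ne_zero
        (show ∑ r ∈ Finset.range i, ∑ c ∈ Finset.Ico (i + 1) n, M r c ≠ 0 by omega)
      obtain ⟨c, hc, h1⟩ := Finset.exists_ne_zero_of_sum_ne_zero h1
      obtain ⟨c', hc', h2⟩ := Finset.exists_ne_zero_of_sum_ne_zero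
        (show ∑ c ∈ Finset.range i, ∑ r ∈ Finset.Ico (i + 1) n, M r c ≠ 0 by omega)
      obtain ⟨r', hr', h2⟩ := Finset.exists_ne_zero_of_sum_ne_zero h2
      simp only [Finset.mem_range, Finset.mem_Ico] at hr hc hr' hc'
      have h0 : M i i ≠ 0 := h0
      exact hM.2.2.2 r i r' c i c' (by omega) (by omega) (by omega) (by omega) (by omega)
        (by omega) (by omega)
  · have := opened_toWalk hM le_rfl (Nat.le_succ n) le_rfl
    simpa using this

theorem toWalk_injOn (n : ℕ) : Set.InjOn toWalk (triFree n) := by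
  have key : ∀ M ∈ triFree n, ∀ N ∈ triFree n, toWalk M = toWalk N →
      ∀ r c, r < c → c < n → M r c = N r c := by
    intro M hM N hN h r c hrc hc
    have := (upper_descentFree hM).ext (upper_descentFree hN) (n := n)
      (fun r hr => by rw [sum_upper_row hM hr, sum_upper_row hN hr, h])
      (fun c hc => by rw [sum_upper_col hc, sum_upper_col hc, h]) (hrc.trans hc) hc
    simpa [upper, hrc] using this
  intro M hM N hN h
  funext r c
  by_cases hrc : r < n ∧ c < n
  · rcases lt_trichotomy r c with hlt | rfl | hlt
    · exact key M hM N hN h r c hlt hrc.2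
    · exact congrArg (fun s => (s r).1) h
    · exact key _ (triFree_transpose hM) _ (triFree_transpose hN)
        (congrArg swap h) c r hlt hrc.1
  · have h1 : M r c = 0 := by
      by_contra h'
      exact hrc (hM.1 r c h')
    have h2 : N r c = 0 := by
      by_contra h'
      exact hrc (hN.1 r c h')
    rw [h1, h2]

/-! ### The matrix of a walk -/

theorem isWalk_swap {n : ℕ} {s : ℕ → ℕ × ℕ × ℕ} (hs : IsWalk n 0 s) : IsWalk n 0 (swap s) := by
  obtain ⟨h1, h2, h3⟩ := hs
  have h4 := opened_add_closed_swap (fun i hi => ⟨(h2 i hi).1, (h2 i hi).2.1⟩) n le_rfl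
  refine ⟨fun i hi => ?_, fun i hi => ?_, by omega⟩
  · simp only [swap, h1 i hi]
    rfl
  · obtain ⟨a, b, c, d, e⟩ := h2 i hi
    exact ⟨b, a, d, c, e.imp_right Or.symm⟩

/-- The descent-free matrix above the diagonal that belongs to a walk. -/
def upperOf (s : ℕ → ℕ × ℕ × ℕ) : ℕ → ℕ → ℕ := overlap (opened s) (closed s)

theorem upperOf_descentFree (s : ℕ → ℕ × ℕ × ℕ) : DescentFree (upperOf s) :=
  overlap_descentFree (opened_mono s) (closed_mono s)

/-- The matrix with diagonal part and parts above and below the diagonal given by a walk. -/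
def toMatrix (n : ℕ) (s : ℕ → ℕ × ℕ × ℕ) (r c : ℕ) : ℕ :=
  if r < n ∧ c < n then
    upperOf s r c + upperOf (swap s) c r + if r = c then (s r).1 else 0
  else 0

theorem toMatrix_swap (n : ℕ) (s : ℕ → ℕ × ℕ × ℕ) (r c : ℕ) :
    toMatrix n (swap s) r c = toMatrix n s c r := by
  have h : swap (swap s) = s := rfl
  simp only [toMatrix, h, and_comm (a := r < n), eq_comm (a := r)]
  by_cases hrc : c = r
  · subst hrc
    simp only [swap]
    split_ifs <;> omega
  · simp only [hrc, if_false]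
    split_ifs <;> omega

theorem upperOf_eq_zero {n : ℕ} {s : ℕ → ℕ × ℕ × ℕ} (hs : IsWalk n 0 s) {r c : ℕ} (hr : r < n)
    (hcr : c ≤ r) : upperOf s r c = 0 := by
  have h1 := closed_mono s (show c + 1 ≤ r + 1 by omega)
  have h2 := (hs.2.1 r hr).2.2.1
  unfold upperOf overlap
  omega

theorem sum_upperOf_col {n : ℕ} {s : ℕ → ℕ × ℕ × ℕ} (hs : IsWalk n 0 s) {c R : ℕ} (hc : c < n)
    (hR : R = n ∨ R = c) : ∑ r ∈ Finset.range R, upperOf s r c = (s c).2.1 := by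
  have h1 := sum_overlap (opened_mono s) (closed_mono s) (opened_zero s) c R
  have h2 := closed_mono s (show c + 1 ≤ n from hc)
  have h3 := closed_succ s c
  have h4 := hs.2.2
  have h5 := (hs.2.1 c hc).2.2.1
  unfold upperOf
  rcases hR with rfl | rfl <;> omega

theorem sum_upperOf_row {n : ℕ} {s : ℕ → ℕ × ℕ × ℕ} (hs : IsWalk n 0 s) {r : ℕ} (hr : r < n) :
    ∑ c ∈ Finset.range n, upperOf s r c = 2 - (s r).1 - (s r).2.2 := by
  have h1 := sum_overlap (closed_mono s) (opened_mono s) (closed_zero s) r n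
  have h2 := opened_mono s (show r + 1 ≤ n from hr)
  have h3 := opened_succ s r
  have h4 := hs.2.2
  unfold upperOf
  simp only [overlap_comm (opened s)]
  omega

theorem sum_toMatrix_row {n : ℕ} {s : ℕ → ℕ × ℕ × ℕ} (hs : IsWalk n 0 s) {r : ℕ} (hr : r < n) :
    ∑ c ∈ Finset.range n, toMatrix n s r c = 2 := by
  have h : ∑ c ∈ Finset.range n, toMatrix n s r c =
      ∑ c ∈ Finset.range n, upperOf s r c + ∑ c ∈ Finset.range n, upperOf (swap s) c r +
        ∑ c ∈ Finset.range n, if r = c then (s r).1 else 0 := by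
    rw [← Finset.sum_add_distrib, ← Finset.sum_add_distrib]
    exact Finset.sum_congr rfl fun c hc => if_pos ⟨hr, Finset.mem_range.1 hc⟩
  rw [h, sum_upperOf_row hs hr, sum_upperOf_col (isWalk_swap hs) hr (Or.inl rfl),
    Finset.sum_ite_eq, if_pos (Finset.mem_range.2 hr)]
  have := hs.2.1 r hr
  simp only [swap]
  unfold StepOK at this
  omega

theorem toMatrix_of_lt {n : ℕ} {s : ℕ → ℕ × ℕ × ℕ} (hs : IsWalk n 0 s) {r c : ℕ} (hrc : r < c)
    (hc : c < n) : toMatrix n s r c = upperOf s r c := by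
  rw [toMatrix, if_pos ⟨hrc.trans hc, hc⟩, upperOf_eq_zero (isWalk_swap hs) hc hrc.le,
    if_neg hrc.ne]
  rfl

theorem toMatrix_diag {n : ℕ} {s : ℕ → ℕ × ℕ × ℕ} (hs : IsWalk n 0 s) {i : ℕ} (hi : i < n) :
    toMatrix n s i i = (s i).1 := by
  rw [toMatrix, if_pos ⟨hi, hi⟩, upperOf_eq_zero (isWalk_swap hs) hi le_rfl,
    upperOf_eq_zero hs hi le_rfl, if_pos rfl, add_zero, zero_add]

theorem toMatrix_lt {n : ℕ} {s : ℕ → ℕ × ℕ × ℕ} {r c : ℕ} (h : toMatrix n s r c ≠ 0) :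
    r < n ∧ c < n := by
  by_contra h'
  exact h (if_neg h')

/-- An entry in a row before `i` and a column after `i` is opened before time `i` and not yet closed
after it. -/
theorem closed_lt_opened {s : ℕ → ℕ × ℕ × ℕ} {r c i : ℕ} (hr : r < i)
    (hc : i < c) (h : 0 < upperOf s r c) : closed s (i + 1) < opened s i := by
  have h1 := opened_mono s (show r + 1 ≤ i from hr)
  have h2 := closed_mono s (show i + 1 ≤ c from hc)
  unfold upperOf overlap at h
  omega

theorem toMatrix_mem {n : ℕ} {s : ℕ → ℕ × ℕ × ℕ} (hs : IsWalk n 0 s) :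
    toMatrix n s ∈ triFree n := by
  refine ⟨fun r c h => toMatrix_lt h, fun r hr => sum_toMatrix_row hs hr, fun c hc => ?_, ?_⟩
  · simp only [← toMatrix_swap n s]
    exact sum_toMatrix_row (isWalk_swap hs) hc
  · intro r₁ r₂ r₃ c₁ c₂ c₃ hr hr' hc' hc h₁ h₂ h₃
    have n₁ := toMatrix_lt h₁.ne'
    have n₂ := toMatrix_lt h₂.ne'
    have n₃ := toMatrix_lt h₃.ne'
    -- If the middle entry is above (below) the diagonal, then so is the first (the last) one.
    rcases lt_trichotomy r₂ c₂ with hlt | rfl | hlt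
    · rw [toMatrix_of_lt hs (by omega) n₁.2] at h₁
      rw [toMatrix_of_lt hs hlt n₂.2] at h₂
      exact upperOf_descentFree s _ _ _ _ hr hc h₁ h₂
    · rw [toMatrix_of_lt hs (by omega) n₁.2] at h₁
      rw [toMatrix_diag hs n₂.1] at h₂
      rw [← toMatrix_swap, toMatrix_of_lt (isWalk_swap hs) (by omega) n₃.1] at h₃
      have k₁ := closed_lt_opened hr hc h₁
      have k₃ := closed_lt_opened hc' hr' h₃
      have := (hs.2.1 r₂ n₂.1).2.2.2.2
      omega
    · rw [← toMatrix_swap, toMatrix_of_lt (isWalk_swap hs) hlt n₂.1] at h₂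
      rw [← toMatrix_swap, toMatrix_of_lt (isWalk_swap hs) (by omega) n₃.1] at h₃
      exact upperOf_descentFree _ _ _ _ _ hc' hr' h₃ h₂

theorem toWalk_toMatrix {n : ℕ} {s : ℕ → ℕ × ℕ × ℕ} (hs : IsWalk n 0 s) :
    toWalk (toMatrix n s) = s := by
  have key : ∀ s, IsWalk n 0 s → ∀ i < n,
      ∑ r ∈ Finset.range i, toMatrix n s r i = (s i).2.1 := by
    intro s hs i hi
    rw [← sum_upperOf_col hs hi (Or.inr rfl)]
    exact Finset.sum_congr rfl fun r hr => toMatrix_of_lt hs (Finset.mem_range.1 hr) hi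
  funext i
  by_cases hi : i < n
  · refine Prod.ext (toMatrix_diag hs hi) (Prod.ext (key s hs i hi) ?_)
    have := key (swap s) (isWalk_swap hs) i hi
    simp only [toMatrix_swap] at this
    exact this
  · rw [hs.1 i (not_lt.1 hi), (toWalk_isWalk (toMatrix_mem hs)).1 i (not_lt.1 hi)]

/-- Matrices without three descending entries correspond to walks. -/
theorem ncard_triFree (n : ℕ) : (triFree n).ncard = {s | IsWalk n 0 s}.ncard := by
  rw [← (toWalk_injOn n).ncard_image]
  congr 1
  ext s
  exact ⟨by rintro ⟨M, hM, rfl⟩; exact toWalk_isWalk hM,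
    fun hs => ⟨_, toMatrix_mem hs, toWalk_toMatrix hs⟩⟩

/-! ### Counting walks -/

/-- The number of walks on `ℤ` with `N` steps in `{-1, 0, 1}` from `0` to `k`. -/
def trinomial : ℕ → ℤ → ℤ
  | 0, k => if k = 0 then 1 else 0
  | N + 1, k => trinomial N (k - 1) + trinomial N k + trinomial N (k + 1)

theorem trinomial_neg (N : ℕ) (k : ℤ) : trinomial N (-k) = trinomial N k := by
  induction N generalizing k with
  | zero => simp [trinomial]
  | succ N ih =>
    simp only [trinomial]
    rw [← ih (k - 1), ← ih (k + 1), ih k, show -(k - 1) = -k + 1 by ring,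
      show -(k + 1) = -k - 1 by ring]
    ring

/-- The height before a last step `t` that leads to height `h`. It is meaningful only if the
subtraction does not truncate, which `lastSteps` demands. -/
def prevHeight (h : ℕ) (t : ℕ × ℕ × ℕ) : ℕ := h + t.1 + t.2.1 + t.2.2 - 2

/-- The admissible last steps of a walk ending at height `h`. -/
def lastSteps (h : ℕ) : Finset (ℕ × ℕ × ℕ) :=
  (Finset.range 3 ×ˢ Finset.range 3 ×ˢ Finset.range 3).filter fun t =>
    2 ≤ h + t.1 + t.2.1 + t.2.2 ∧ t.1 + t.2.1 ≤ 2 ∧ t.1 + t.2.2 ≤ 2 ∧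
      t.2.1 ≤ prevHeight h t ∧ t.2.2 ≤ prevHeight h t ∧
      (t.1 = 0 ∨ t.2.1 = prevHeight h t ∨ t.2.2 = prevHeight h t)

theorem mem_lastSteps {h : ℕ} {t : ℕ × ℕ × ℕ} : t ∈ lastSteps h ↔
    2 ≤ h + t.1 + t.2.1 + t.2.2 ∧ t.1 + t.2.1 ≤ 2 ∧ t.1 + t.2.2 ≤ 2 ∧
      t.2.1 ≤ prevHeight h t ∧ t.2.2 ≤ prevHeight h t ∧
      (t.1 = 0 ∨ t.2.1 = prevHeight h t ∨ t.2.2 = prevHeight h t) := by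
  rw [lastSteps, Finset.mem_filter, and_iff_right_iff_imp]
  intro h
  simp only [Finset.mem_product, Finset.mem_range]
  omega

theorem opened_congr {s s' : ℕ → ℕ × ℕ × ℕ} {i : ℕ} (h : ∀ k < i, s k = s' k) :
    opened s i = opened s' i :=
  Finset.sum_congr rfl fun k hk => by rw [h k (Finset.mem_range.1 hk)]

theorem closed_congr {s s' : ℕ → ℕ × ℕ × ℕ} {i : ℕ} (h : ∀ k < i, s k = s' k) :
    closed s i = closed s' i :=
  Finset.sum_congr rfl fun k hk => by rw [h k (Finset.mem_range.1 hk)]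

theorem stepOK_congr {s s' : ℕ → ℕ × ℕ × ℕ} {i : ℕ} (h : ∀ k < i + 1, s k = s' k) :
    StepOK s i ↔ StepOK s' i := by
  have h' : ∀ k < i, s k = s' k := fun k hk => h k (by omega)
  have hs : ∀ k < i + 1, swap s k = swap s' k := fun k hk => by rw [swap, swap, h k hk]
  have hs' : ∀ k < i, swap s k = swap s' k := fun k hk => hs k (by omega)
  rw [StepOK, StepOK, h i (by omega), opened_congr h', closed_congr h, opened_congr hs',
    closed_congr hs]

/-- Decomposition of a walk at its last step. -/
theorem isWalk_update {n h : ℕ} {s : ℕ → ℕ × ℕ × ℕ} {t : ℕ × ℕ × ℕ} (hs : ∀ i, n ≤ i → s i = 0) :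
    IsWalk (n + 1) h (Function.update s n t) ↔
      t ∈ lastSteps h ∧ IsWalk n (prevHeight h t) s := by
  set s' := Function.update s n t with hs'
  have e : ∀ k < n, s' k = s k := fun k hk => Function.update_of_ne hk.ne _ _
  have en : s' n = t := Function.update_self _ _ _
  have esw : ∀ k < n, swap s' k = swap s k := fun k hk => by rw [swap, swap, e k hk]
  have h1 : ∀ i, n + 1 ≤ i → s' i = 0 := fun i hi => by
    rw [hs', Function.update_of_ne (by omega), hs i (by omega)]
  have h2 : (∀ i < n + 1, StepOK s' i) ↔ (∀ i < n, StepOK s i) ∧ StepOK s' n := by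
    rw [Nat.forall_lt_succ_right]
    refine and_congr_left fun _ => forall₂_congr fun i hi => stepOK_congr fun k hk => e k ?_
    omega
  unfold IsWalk
  rw [h2]
  rw [and_iff_right h1, and_iff_right hs, and_assoc, and_left_comm (a := t ∈ lastSteps h)]
  refine and_congr_right fun hok => ?_
  have hsym := opened_add_closed_swap (s := s) (fun i hi => ⟨(hok i hi).1, (hok i hi).2.1⟩) n le_rfl
  rw [StepOK, mem_lastSteps, opened_succ, closed_succ, closed_succ, opened_congr e,
    closed_congr e, opened_congr esw, closed_congr esw, show (swap s' n).2.1 = (s' n).2.2 from rfl, en]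
  simp only [prevHeight]
  omega

open Classical in
/-- The finite set of walks with `n` steps from height `0` to height `h`. -/
noncomputable def walks : ℕ → ℕ → Finset (ℕ → ℕ × ℕ × ℕ)
  | 0, h => if h = 0 then {0} else ∅
  | n + 1, h => (lastSteps h).biUnion fun t =>
      (walks n (prevHeight h t)).image fun s => Function.update s n t

theorem mem_walks {n h : ℕ} {s : ℕ → ℕ × ℕ × ℕ} : s ∈ walks n h ↔ IsWalk n h s := by
  induction n generalizing h s with
  | zero =>
    have : IsWalk 0 h s ↔ s = 0 ∧ h = 0 := by
      simp [IsWalk, opened_zero, closed_zero, funext_iff, eq_comm]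
    rw [this, walks]
    split_ifs with h0 <;> simp [h0]
  | succ n ih =>
    simp only [walks, Finset.mem_biUnion, Finset.mem_image, ih]
    constructor
    · rintro ⟨t, ht, s, hs, rfl⟩
      exact (isWalk_update hs.1).2 ⟨ht, hs⟩
    · intro hs
      have e : Function.update (Function.update s n 0) n (s n) = s := by simp
      rw [← e, isWalk_update] at hs
      · exact ⟨_, hs.1, _, hs.2, e⟩
      · intro i hi
        rcases hi.eq_or_lt with rfl | hi
        · simp
        · rw [Function.update_of_ne (by omega), ← hs.1 i hi, e]

open Classical in
theorem card_walks_succ (n h : ℕ) :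
    (walks (n + 1) h).card = ∑ t ∈ lastSteps h, (walks n (prevHeight h t)).card := by
  rw [walks, Finset.card_biUnion]
  · refine Finset.sum_congr rfl fun t _ => Finset.card_image_of_injOn ?_
    intro s hs s' hs' hss
    have e : ∀ u ∈ walks n (prevHeight h t), u = Function.update (Function.update u n t) n 0 := by
      intro u hu
      rw [Function.update_idem, ← (mem_walks.1 hu).1 n le_rfl, Function.update_eq_self]
    rw [e s hs, e s' hs']
    exact congrArg (fun u => Function.update u n 0) hss
  · intro t _ t' _ hne
    refine Finset.disjoint_left.2 ?_
    intro s hs hs'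
    obtain ⟨u, -, rfl⟩ := Finset.mem_image.1 hs
    obtain ⟨u', -, h⟩ := Finset.mem_image.1 hs'
    have := congrFun h n
    simp only [Function.update_self] at this
    exact hne this.symm

theorem lastSteps_add_two (h : ℕ) :
    lastSteps (h + 2) = {(0 : ℕ)} ×ˢ Finset.range 3 ×ˢ Finset.range 3 := by
  ext ⟨m, a, b⟩
  simp only [mem_lastSteps, prevHeight, Finset.mem_product, Finset.mem_range,
    Finset.mem_singleton]
  omega

/-- The reflection principle: one step of a walk amounts to two steps in `{-1, 0, 1}` on `ℕ`,
without the step `0` at height `0`, and these are counted by antisymmetric extension of the count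
to `ℤ`, the centre of reflection being `-1 / 2`. -/
theorem card_walks (n h : ℕ) :
    ((walks n h).card : ℤ) = trinomial (2 * n) h - trinomial (2 * n) (h + 1) := by
  induction n generalizing h with
  | zero =>
    have h' : (h : ℤ) + 1 ≠ 0 := by omega
    by_cases h0 : h = 0 <;> simp [walks, trinomial, h0, h']
  | succ n ih =>
    rw [card_walks_succ, Nat.cast_sum, Finset.sum_congr rfl fun t _ => ih (prevHeight h t),
      show 2 * (n + 1) = 2 * n + 1 + 1 by ring]
    have s1 := trinomial_neg (2 * n) 1
    have s2 := trinomial_neg (2 * n) 2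
    simp only [trinomial]
    match h with
    | 0 =>
      rw [show lastSteps 0 = {(0, 2, 2), (1, 1, 1), (2, 0, 0)} by decide]
      norm_num [prevHeight]
      linarith
    | 1 =>
      rw [show lastSteps 1 = {(0, 1, 2), (0, 2, 1), (0, 1, 1), (0, 2, 2), (1, 0, 0), (1, 0, 1),
        (1, 1, 0)} by decide]
      norm_num [prevHeight]
      linarith
    | h + 2 =>
      rw [lastSteps_add_two, Finset.sum_product, Finset.sum_singleton, Finset.sum_product]
      simp only [Finset.sum_range_succ, Finset.sum_range_zero, prevHeight]
      push_cast
      ring_nf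

/-! ### Planar matchings as chains -/

theorem planarMatching_card_le_two_iff {n : ℕ} {M : Matrix (Fin n) (Fin n) ℕ} :
    (∀ S, IsPlanarMatching M S → S.card ≤ 2) ↔
      ∀ u₁ u₂ u₃ v₁ v₂ v₃, u₁ < u₂ → u₂ < u₃ → v₁ < v₂ → v₂ < v₃ →
        0 < M u₁ v₁ → 0 < M u₂ v₂ → 0 < M u₃ v₃ → False := by
  constructor
  · intro h u₁ u₂ u₃ v₁ v₂ v₃ hu hu' hv hv' h₁ h₂ h₃
    have hc := h {(u₁, v₁), (u₂, v₂), (u₃, v₃)} ⟨?_, ?_⟩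
    · rw [Finset.card_eq_three.2 ⟨_, _, _, ?_, ?_, ?_, rfl⟩] at hc
      · omega
      all_goals
        rw [Ne, Prod.mk.injEq]
        omega
    · simp [h₁, h₂, h₃]
    · simp only [Finset.mem_insert, Finset.mem_singleton, Noncrossing]
      rintro e (rfl | rfl | rfl) f (rfl | rfl | rfl) hne <;>
        first
        | exact absurd rfl hne
        | exact Or.inl ⟨by assumption, by assumption⟩
        | exact Or.inr ⟨by assumption, by assumption⟩
        | exact Or.inl ⟨hu.trans hu', hv.trans hv'⟩
        | exact Or.inr ⟨hu.trans hu', hv.trans hv'⟩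
  · rintro h S ⟨hpos, hS⟩
    by_contra! hc
    obtain ⟨e, f, g, he, hf, hg, h1, h2, h3⟩ := Finset.two_lt_card_iff.1 hc
    have pe := hpos e he
    have pf := hpos f hf
    have pg := hpos g hg
    rcases hS e he f hf h1 with ⟨a, a'⟩ | ⟨a, a'⟩ <;>
      rcases hS e he g hg h2 with ⟨b, b'⟩ | ⟨b, b'⟩ <;>
      rcases hS f hf g hg h3 with ⟨c, c'⟩ | ⟨c, c'⟩
    · exact h _ _ _ _ _ _ a c a' c' pe pf pg
    · exact h _ _ _ _ _ _ b c b' c' pe pg pf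
    · exact absurd (a.trans c) b.asymm
    · exact h _ _ _ _ _ _ b a b' a' pg pe pf
    · exact h _ _ _ _ _ _ a b a' b' pf pe pg
    · exact absurd (c.trans a) b.asymm
    · exact h _ _ _ _ _ _ c b c' b' pf pg pe
    · exact h _ _ _ _ _ _ c a c' a' pg pf pe

/-- The matrix with reversed order of columns, extended by zero. Noncrossing edges become entries
in strictly descending position. -/
def flipExtend {n : ℕ} (M : Matrix (Fin n) (Fin n) ℕ) (r c : ℕ) : ℕ :=
  if h : r < n ∧ c < n then M ⟨r, h.1⟩ (Fin.rev ⟨c, h.2⟩) else 0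

theorem flipExtend_apply {n : ℕ} (M : Matrix (Fin n) (Fin n) ℕ) (u v : Fin n) :
    flipExtend M u v = M u v.rev := dif_pos ⟨u.2, v.2⟩

theorem flipExtend_injective (n : ℕ) :
    Function.Injective (flipExtend : Matrix (Fin n) (Fin n) ℕ → ℕ → ℕ → ℕ) := by
  intro M N h
  ext u v
  have := congrFun (congrFun h u) (v.rev : Fin n)
  rwa [flipExtend_apply, flipExtend_apply, Fin.rev_rev] at this

theorem flipExtend_mem_iff {n : ℕ} {M : Matrix (Fin n) (Fin n) ℕ} :
    flipExtend M ∈ triFree n ↔ M ∈ graphs 2 n 2 := by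
  have hlt : ∀ r c, flipExtend M r c ≠ 0 → r < n ∧ c < n := fun r c h => by
    by_contra h'
    exact h (dif_neg h')
  have hrow : (∀ r < n, ∑ c ∈ Finset.range n, flipExtend M r c = 2) ↔ ∀ u, ∑ v, M u v = 2 := by
    rw [Fin.forall_iff]
    refine forall₂_congr fun r hr => ?_
    rw [Finset.sum_range, ← Equiv.sum_comp Fin.revPerm]
    simp only [fun v => flipExtend_apply M ⟨r, hr⟩ v, Fin.revPerm_apply, Fin.rev_rev]
  have hcol : (∀ c < n, ∑ r ∈ Finset.range n, flipExtend M r c = 2) ↔ ∀ v, ∑ u, M u v = 2 := by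
    rw [Fin.rev_surjective.forall (p := fun v => ∑ u, M u v = 2), Fin.forall_iff]
    refine forall₂_congr fun c hc => ?_
    rw [Finset.sum_range]
    simp only [fun u => flipExtend_apply M u ⟨c, hc⟩]
  rw [triFree, graphs, Set.mem_ofPred_eq, Set.mem_ofPred_eq, and_iff_right hlt, hrow, hcol, IsRegular,
    and_assoc, planarMatching_card_le_two_iff]
  refine and_congr_right fun _ => and_congr_right fun _ => ⟨fun h => ?_, fun h => ?_⟩
  · intro u₁ u₂ u₃ v₁ v₂ v₃ hu hu' hv hv' h₁ h₂ h₃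
    rw [← Fin.rev_rev v₁, ← flipExtend_apply M] at h₁
    rw [← Fin.rev_rev v₂, ← flipExtend_apply M] at h₂
    rw [← Fin.rev_rev v₃, ← flipExtend_apply M] at h₃
    exact h _ _ _ _ _ _ hu hu' (Fin.rev_lt_rev.2 hv') (Fin.rev_lt_rev.2 hv) h₁ h₂ h₃
  · intro r₁ r₂ r₃ c₁ c₂ c₃ hr hr' hc' hc h₁ h₂ h₃
    have n₁ := hlt _ _ h₁.ne'
    have n₂ := hlt _ _ h₂.ne'
    have n₃ := hlt _ _ h₃.ne'
    refine h ⟨r₁, n₁.1⟩ ⟨r₂, n₂.1⟩ ⟨r₃, n₃.1⟩ (Fin.rev ⟨c₁, n₁.2⟩) (Fin.rev ⟨c₂, n₂.2⟩)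
      (Fin.rev ⟨c₃, n₃.2⟩) hr hr' (Fin.rev_lt_rev.2 hc) (Fin.rev_lt_rev.2 hc') ?_ ?_ ?_
    · rwa [← flipExtend_apply M]
    · rwa [← flipExtend_apply M]
    · rwa [← flipExtend_apply M]

theorem image_graphs (n : ℕ) : flipExtend '' graphs 2 n 2 = triFree n := by
  ext N
  constructor
  · rintro ⟨M, hM, rfl⟩
    exact flipExtend_mem_iff.2 hM
  · intro hN
    have e : flipExtend (Matrix.of fun u v : Fin n => N u v.rev) = N := by
      funext r c
      by_cases h : r < n ∧ c < n
      · rw [flipExtend, dif_pos h, Matrix.of_apply, Fin.rev_rev]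
      · rw [flipExtend, dif_neg h]
        by_contra h'
        exact h (hN.1 r c (Ne.symm h'))
    exact ⟨_, flipExtend_mem_iff.1 (e.symm ▸ hN), e⟩

/-- The number of graphs is a Riordan number, a difference of trinomial coefficients. -/
theorem g_two_two (n : ℕ) : (g 2 n 2 : ℤ) = trinomial (2 * n) 0 - trinomial (2 * n) 1 := by
  have h := card_walks n 0
  have e : {s | IsWalk n 0 s} = ↑(walks n 0) := Set.ext fun s => mem_walks.symm
  rw [g, ← (flipExtend_injective n).injOn.ncard_image, image_graphs, ncard_triFree, e,
    Set.ncard_coe_finset]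
  simpa using h

/-! ### Trinomial coefficients -/

theorem trinomial_eq_zero {N : ℕ} {k : ℤ} (h : (N : ℤ) < |k|) : trinomial N k = 0 := by
  induction N generalizing k with
  | zero =>
    have : k ≠ 0 := by rintro rfl; simp at h
    simp [trinomial, this]
  | succ N ih =>
    push_cast at h
    rw [lt_abs] at h
    simp only [trinomial]
    rw [ih, ih, ih] <;> (try rw [lt_abs]) <;> omega

theorem coeff_trinomial_pow (n s : ℕ) :
    ((1 + Polynomial.X + Polynomial.X ^ 2 : Polynomial ℚ) ^ n).coeff s = trinomial n (s - n) := by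
  induction n generalizing s with
  | zero => simp [trinomial, Polynomial.coeff_one]
  | succ n ih =>
    have e : (1 + Polynomial.X + Polynomial.X ^ 2 : Polynomial ℚ) ^ (n + 1) =
        (1 + Polynomial.X + Polynomial.X ^ 2) ^ n +
          (1 + Polynomial.X + Polynomial.X ^ 2) ^ n * Polynomial.X +
          (1 + Polynomial.X + Polynomial.X ^ 2) ^ n * Polynomial.X * Polynomial.X := by ring
    rw [e, Polynomial.coeff_add, Polynomial.coeff_add]
    match s with
    | 0 =>
      rw [Polynomial.coeff_mul_X_zero, Polynomial.coeff_mul_X_zero, ih]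
      simp only [trinomial]
      rw [trinomial_eq_zero (k := ((0 : ℕ) : ℤ) - ((n + 1 : ℕ) : ℤ) - 1),
        trinomial_eq_zero (k := ((0 : ℕ) : ℤ) - ((n + 1 : ℕ) : ℤ))]
      · push_cast; ring_nf
      all_goals
        rw [lt_abs]
        push_cast
        omega
    | 1 =>
      rw [Polynomial.coeff_mul_X, Polynomial.coeff_mul_X, Polynomial.coeff_mul_X_zero, ih, ih]
      simp only [trinomial]
      rw [trinomial_eq_zero (k := ((1 : ℕ) : ℤ) - ((n + 1 : ℕ) : ℤ) - 1)]
      · push_cast; ring_nf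
      · rw [lt_abs]
        push_cast
        omega
    | s + 2 =>
      rw [Polynomial.coeff_mul_X, Polynomial.coeff_mul_X, Polynomial.coeff_mul_X, ih, ih, ih]
      simp only [trinomial]
      push_cast
      ring_nf

/-- The sum over `k` that `𝒟` produces from the powers of `a₁, a₂` (or of `b₁, b₂`). -/
def derivSum (n α γ : ℕ) : ℚ :=
  ∑ k ∈ Finset.range (n + 1), (-1) ^ k * n.choose k * (2 * (n - k)).factorial *
    (α.descFactorial k * γ.descFactorial k)

/-- Expansion of `((1 + X) ^ 2 - X) ^ n`. -/
theorem derivSum_eq {n α γ : ℕ} (h : α + γ = 2 * n) :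
    derivSum n α γ = α.factorial * γ.factorial * trinomial n (α - n) := by
  have e : (1 + Polynomial.X + Polynomial.X ^ 2 : Polynomial ℚ) =
      -Polynomial.X + (1 + Polynomial.X) ^ 2 := by ring
  rw [← coeff_trinomial_pow, e, add_pow, Polynomial.finsetSum_coeff, derivSum, Finset.mul_sum]
  refine Finset.sum_congr rfl fun k hk => ?_
  have hk := Finset.mem_range_succ_iff.1 hk
  have e2 : (-Polynomial.X) ^ k * ((1 + Polynomial.X) ^ 2) ^ (n - k) * (n.choose k : Polynomial ℚ) =
      Polynomial.C ((-1) ^ k * (n.choose k : ℚ)) *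
        (Polynomial.X ^ k * (1 + Polynomial.X) ^ (2 * (n - k))) := by
    rw [neg_pow, ← pow_mul]
    simp only [Polynomial.C_mul, Polynomial.C_pow, Polynomial.C_neg, Polynomial.C_1,
      Polynomial.C_eq_natCast]
    ring
  rw [e2, Polynomial.coeff_C_mul, Polynomial.coeff_X_pow_mul', Polynomial.coeff_one_add_X_pow]
  by_cases hα : k ≤ α
  · by_cases hγ : k ≤ γ
    · have h1 : (k.factorial : ℚ) ≠ 0 := by positivity
      have h2 := Nat.factorial_mul_descFactorial hα
      have h3 := Nat.factorial_mul_descFactorial hγ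
      have h4 := Nat.choose_mul_factorial_mul_factorial (show α - k ≤ 2 * (n - k) by omega)
      rw [show 2 * (n - k) - (α - k) = γ - k by omega] at h4
      rw [if_pos hα, ← h2, ← h3, ← h4]
      push_cast
      ring
    · rw [Nat.descFactorial_of_lt (not_le.1 hγ), 
        Nat.choose_eq_zero_of_lt (show 2 * (n - k) < α - k by omega)]
      simp
  · rw [if_neg hα, Nat.descFactorial_of_lt (not_le.1 hα)]
    simp

theorem sum_trinomial_sq (n : ℕ) :
    ∑ p ∈ Finset.HasAntidiagonal.antidiagonal (2 * n), (trinomial n (p.1 - n) : ℚ) ^ 2 =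
      trinomial (2 * n) 0 := by
  have h := coeff_trinomial_pow (2 * n) (2 * n)
  rw [sub_self, two_mul n, pow_add, Polynomial.coeff_mul, ← two_mul] at h
  rw [← h]
  refine Finset.sum_congr rfl fun p hp => ?_
  have hp := Finset.HasAntidiagonal.mem_antidiagonal.1 hp
  rw [coeff_trinomial_pow, coeff_trinomial_pow, pow_two, ← trinomial_neg n ((p.2 : ℤ) - n)]
  congr 3
  omega

theorem sum_trinomial_mul_succ (n : ℕ) :
    ∑ p ∈ Finset.HasAntidiagonal.antidiagonal (2 * n + 1),
      (trinomial (n + 1) (p.1 - (n + 1)) * trinomial (n + 1) (p.1 + 1 - (n + 1)) : ℚ) =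
      trinomial (2 * (n + 1)) 1 := by
  have h := coeff_trinomial_pow (2 * (n + 1)) (2 * n + 1)
  rw [two_mul (n + 1), pow_add, Polynomial.coeff_mul, ← two_mul, ← trinomial_neg] at h
  rw [show -(((2 * n + 1 : ℕ) : ℤ) - ((2 * (n + 1) : ℕ) : ℤ)) = 1 by push_cast; ring] at h
  rw [← h]
  refine Finset.sum_congr rfl fun p hp => ?_
  have hp := Finset.HasAntidiagonal.mem_antidiagonal.1 hp
  rw [coeff_trinomial_pow, coeff_trinomial_pow,
    ← trinomial_neg (n + 1) ((p.2 : ℤ) - ((n + 1 : ℕ) : ℤ))]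
  push_cast
  congr 3
  omega

/-! ### The operator on monomials -/

instance : Fintype Sgn := ⟨{Sgn.plus, Sgn.minus}, fun x => by cases x <;> simp⟩

instance : Fintype AB := ⟨{AB.a1, AB.b1, AB.a2, AB.b2}, fun x => by cases x <;> simp⟩

theorem pderiv_iterate_monomial {σ : Type*} (i : σ) (k : ℕ) (m : σ →₀ ℕ) (c : ℚ) :
    (MvPolynomial.pderiv i)^[k] (MvPolynomial.monomial m c) =
      MvPolynomial.monomial (m - Finsupp.single i k) (c * (m i).descFactorial k) := by
  induction k with
  | zero => simp
  | succ k ih =>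
    rw [Function.iterate_succ_apply', ih, MvPolynomial.pderiv_monomial, tsub_tsub,
      ← Finsupp.single_add, Nat.descFactorial_succ, Finsupp.tsub_apply, Finsupp.single_eq_same]
    congr 1
    push_cast
    ring

theorem primitive_monomial {σ : Type*} (i : σ) (m : σ →₀ ℕ) (c : ℚ) :
    primitive i (MvPolynomial.monomial m c) =
      MvPolynomial.monomial (m + Finsupp.single i 1) (c / (m i + 1)) := by
  have h : MvPolynomial.monomial m c = c • MvPolynomial.basisMonomials σ ℚ m := by
    simp [MvPolynomial.smul_monomial]
  rw [h, map_smul, primitive, Module.Basis.constr_basis, MvPolynomial.smul_monomial, smul_eq_mul,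
    mul_one_div]

theorem primitive_iterate_monomial {σ : Type*} (i : σ) (k : ℕ) (m : σ →₀ ℕ) (c : ℚ) :
    (primitive i)^[k] (MvPolynomial.monomial m c) =
      MvPolynomial.monomial (m + Finsupp.single i k) (c / (m i + 1).ascFactorial k) := by
  induction k with
  | zero => simp
  | succ k ih =>
    rw [Function.iterate_succ_apply', ih, primitive_monomial, add_assoc, ← Finsupp.single_add,
      Nat.ascFactorial_succ, Finsupp.add_apply, Finsupp.single_eq_same, div_div]
    congr 2
    push_cast
    ring

theorem setABOne_monomial (m : Sgn ⊕ AB →₀ ℕ) (c : ℚ) :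
    setABOne (MvPolynomial.monomial m c) =
      MvPolynomial.monomial (Finsupp.comapDomain Sum.inl m Sum.inl_injective.injOn) c := by
  rw [setABOne, MvPolynomial.aeval_monomial, Finsupp.prod_fintype _ _ (by simp),
    Fintype.prod_sum_type, MvPolynomial.monomial_eq, Finsupp.prod_fintype _ _ (by simp)]
  simp [MvPolynomial.algebraMap_eq]

theorem setYSq_monomial (m : Sgn →₀ ℕ) (c : ℚ) :
    setYSq (MvPolynomial.monomial m c) = MvPolynomial.monomial (2 • m) c := by
  rw [setYSq, MvPolynomial.aeval_monomial, Finsupp.prod_fintype _ _ (by simp),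
    MvPolynomial.monomial_eq, Finsupp.prod_fintype _ _ (by simp)]
  simp [MvPolynomial.algebraMap_eq, pow_mul]

theorem setZOne_monomial (m : Sgn →₀ ℕ) (c : ℚ) : setZOne (MvPolynomial.monomial m c) = c := by
  simp [setZOne, MvPolynomial.aeval_monomial]

theorem integralPart_monomial (m : Sgn ⊕ AB →₀ ℕ) (c : ℚ) :
    integralPart (MvPolynomial.monomial m c) =
      if Even (m (Sum.inl Sgn.plus)) ∧ Even (m (Sum.inl Sgn.minus)) then
        MvPolynomial.monomial
          (Finsupp.sumElim ((Finsupp.comapDomain Sum.inl m Sum.inl_injective.injOn).mapRange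
              (fun p => p / 2) (Nat.zero_div 2))
            (Finsupp.comapDomain Sum.inr m Sum.inr_injective.injOn)) c
      else 0 := by
  have h : MvPolynomial.monomial m c = c • MvPolynomial.basisMonomials (Sgn ⊕ AB) ℚ m := by
    simp [MvPolynomial.smul_monomial]
  rw [h, map_smul, integralPart, Module.Basis.constr_basis, smul_ite, smul_zero,
    MvPolynomial.smul_monomial, smul_eq_mul, mul_one]

/-- The factor of a term of `𝒟` that stems from the variables of one sign. -/
def derivTerm (n α γ k : ℕ) : ℚ :=
  (-1) ^ k / k.factorial * (α.descFactorial k * γ.descFactorial k) * n.descFactorial k /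
    (2 * (n - k) + 1).ascFactorial (2 * k)

theorem Dterm_monomial (k l : ℕ) (m : Sgn ⊕ AB →₀ ℕ) (c : ℚ) :
    Dterm k l (MvPolynomial.monomial m c) =
      c * derivTerm (m (Sum.inl Sgn.plus)) (m (Sum.inr AB.a1)) (m (Sum.inr AB.a2)) k *
        derivTerm (m (Sum.inl Sgn.minus)) (m (Sum.inr AB.b1)) (m (Sum.inr AB.b2)) l := by
  simp only [Dterm, diffAB, diffY, primZ, pderiv_iterate_monomial, setABOne_monomial,
    setYSq_monomial, primitive_iterate_monomial, setZOne_monomial]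
  simp only [Finsupp.tsub_apply, Finsupp.add_apply, Finsupp.comapDomain_apply, Finsupp.smul_apply,
    Finsupp.single_apply, Sum.inr.injEq, reduceCtorEq, if_false, if_true, tsub_zero, add_zero,
    smul_eq_mul, derivTerm]
  rw [pow_add]
  field_simp

theorem Dterm_add (k l : ℕ) (f g : YABRing) : Dterm k l (f + g) = Dterm k l f + Dterm k l g := by
  simp only [Dterm, diffAB, diffY, primZ, iterate_map_add, map_add, mul_add]

/-- `𝒟` on polynomials as an additive map. -/
noncomputable def DpolyHom : YABRing →+ ℚ :=
  AddMonoidHom.mk' Dpoly fun f g => by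
    simp only [Dpoly, Dterm_add]
    exact finsum_add_distrib (Dterm_support_finite f) (Dterm_support_finite g)

/-- The functional applied to each coefficient of the determinant. -/
noncomputable def coeffFunctional : HalfRing →+ ℚ :=
  DpolyHom.comp integralPart.toAddMonoidHom

theorem derivTerm_of_lt {n α γ k : ℕ} (h : n < k) : derivTerm n α γ k = 0 := by
  simp [derivTerm, Nat.descFactorial_of_lt h]

theorem sum_derivTerm (n α γ : ℕ) :
    ∑ k ∈ Finset.range (n + 1), derivTerm n α γ k = derivSum n α γ / (2 * n).factorial := by
  rw [derivSum, Finset.sum_div]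
  refine Finset.sum_congr rfl fun k hk => ?_
  have hk := Finset.mem_range_succ_iff.1 hk
  have h1 := Nat.factorial_mul_ascFactorial (2 * (n - k)) (2 * k)
  rw [show 2 * (n - k) + 2 * k = 2 * n by omega] at h1
  have h2 := Nat.descFactorial_eq_factorial_mul_choose n k
  have p1 : ((2 * (n - k)).factorial : ℚ) ≠ 0 := by positivity
  have p2 : (((2 * (n - k) + 1).ascFactorial (2 * k) : ℕ) : ℚ) ≠ 0 :=
    Nat.cast_ne_zero.2 (Nat.ascFactorial_pos _ _).ne'
  have p3 : (k.factorial : ℚ) ≠ 0 := by positivity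
  rw [← h1, derivTerm, h2]
  push_cast
  field_simp

theorem Dpoly_monomial (m : Sgn ⊕ AB →₀ ℕ) (c : ℚ) :
    Dpoly (MvPolynomial.monomial m c) =
      c * (derivSum (m (Sum.inl Sgn.plus)) (m (Sum.inr AB.a1)) (m (Sum.inr AB.a2)) /
          (2 * m (Sum.inl Sgn.plus)).factorial) *
        (derivSum (m (Sum.inl Sgn.minus)) (m (Sum.inr AB.b1)) (m (Sum.inr AB.b2)) /
          (2 * m (Sum.inl Sgn.minus)).factorial) := by
  simp only [Dpoly, Dterm_monomial]
  rw [finsum_eq_sum_of_support_subset (s := Finset.range (m (Sum.inl Sgn.plus) + 1) ×ˢ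
      Finset.range (m (Sum.inl Sgn.minus) + 1)), Finset.sum_product, ← sum_derivTerm,
    ← sum_derivTerm, mul_assoc, Finset.sum_mul_sum, Finset.mul_sum]
  · refine Finset.sum_congr rfl fun k _ => ?_
    rw [Finset.mul_sum]
    simp only [mul_assoc]
  · rintro ⟨k, l⟩ h
    rw [Function.mem_support] at h
    simp only [Finset.coe_product, Set.mem_prod, Finset.mem_coe, Finset.mem_range_succ_iff]
    constructor
    · by_contra! hk
      exact h (by rw [derivTerm_of_lt hk, mul_zero, zero_mul])
    · by_contra! hl
      exact h (by rw [derivTerm_of_lt hl, mul_zero])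

theorem coeffFunctional_monomial {m : Sgn ⊕ AB →₀ ℕ} {c : ℚ} {K : ℕ}
    (hp : m (Sum.inl Sgn.plus) = K) (hq : m (Sum.inl Sgn.minus) = K) :
    coeffFunctional (MvPolynomial.monomial m c) = if Even K then
      c * (derivSum (K / 2) (m (Sum.inr AB.a1)) (m (Sum.inr AB.a2)) / K.factorial) *
        (derivSum (K / 2) (m (Sum.inr AB.b1)) (m (Sum.inr AB.b2)) / K.factorial) else 0 := by
  change Dpoly (integralPart _) = _
  rw [integralPart_monomial]
  by_cases h : Even K
  · rw [if_pos ⟨hp.symm ▸ h, hq.symm ▸ h⟩, if_pos h, Dpoly_monomial]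
    simp [hp, hq, Nat.two_mul_div_two_of_even h]
  · rw [if_neg fun h' => h (hp ▸ h'.1), if_neg h]
    exact DpolyHom.map_zero

/-! ### The coefficients of the determinant -/

/-- The vector of exponents of `y_+^{1/2}, y_-^{1/2}, a₁, b₁, a₂, b₂`. -/
noncomputable def exponents (p q α β γ δ : ℕ) : Sgn ⊕ AB →₀ ℕ :=
  Finsupp.equivFunOnFinite.symm fun i => match i with
    | Sum.inl Sgn.plus => p
    | Sum.inl Sgn.minus => q
    | Sum.inr AB.a1 => α
    | Sum.inr AB.b1 => β
    | Sum.inr AB.a2 => γ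
    | Sum.inr AB.b2 => δ

theorem exponents_add (p q α β γ δ p' q' α' β' γ' δ' : ℕ) :
    exponents p q α β γ δ + exponents p' q' α' β' γ' δ' =
      exponents (p + p') (q + q') (α + α') (β + β') (γ + γ') (δ + δ') := by
  ext i
  rcases i with (_ | _) | (_ | _ | _ | _) <;> rfl

theorem coeff_entryI0_of_not_even (a b : AB) {N : ℕ} (h : ¬Even N) :
    PowerSeries.coeff N (entryI0 a b) = 0 := by
  rw [entryI0, besselI0Sqrt, PowerSeries.coeff_mk, if_neg h]

theorem coeff_entryI0 (a b : AB) (s : ℕ) :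
    PowerSeries.coeff (2 * s) (entryI0 a b) =
      MvPolynomial.monomial (Finsupp.single (Sum.inl Sgn.plus) s +
        Finsupp.single (Sum.inl Sgn.minus) s + Finsupp.single (Sum.inr a) s +
        Finsupp.single (Sum.inr b) s) (1 / (s.factorial * s.factorial) : ℚ) := by
  rw [entryI0, besselI0Sqrt, PowerSeries.coeff_mk, if_pos (even_two_mul s),
    Nat.mul_div_cancel_left s two_pos]
  simp only [sqrtY, ab, mul_pow, MvPolynomial.X_pow_eq_monomial, MvPolynomial.monomial_mul,
    MvPolynomial.smul_monomial, mul_one, smul_eq_mul]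

theorem coeff_entryI0_a1_b1 (s : ℕ) :
    PowerSeries.coeff (2 * s) (entryI0 AB.a1 AB.b1) =
      MvPolynomial.monomial (exponents s s s s 0 0) (1 / (s.factorial * s.factorial) : ℚ) := by
  rw [coeff_entryI0]
  congr 2
  ext i
  rcases i with (_ | _) | (_ | _ | _ | _) <;> simp [exponents]

theorem coeff_entryI0_a2_b2 (s : ℕ) :
    PowerSeries.coeff (2 * s) (entryI0 AB.a2 AB.b2) =
      MvPolynomial.monomial (exponents s s 0 0 s s) (1 / (s.factorial * s.factorial) : ℚ) := by
  rw [coeff_entryI0]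
  congr 2
  ext i
  rcases i with (_ | _) | (_ | _ | _ | _) <;> simp [exponents]

theorem coeff_prim_of_not_even (ε : Sgn) (a b c : AB) {N : ℕ} (h : ¬Even N) :
    PowerSeries.coeff N (PowerSeries.C (sqrtY ε) * primAB c (entryI0 a b)) = 0 := by
  rw [PowerSeries.coeff_C_mul, primAB, coeffwise, PowerSeries.coeff_mk,
    coeff_entryI0_of_not_even a b h, map_zero, mul_zero]

theorem coeff_prim_b1 (s : ℕ) :
    PowerSeries.coeff (2 * s)
        (PowerSeries.C (sqrtY Sgn.minus) * primAB AB.b1 (entryI0 AB.a1 AB.b1)) =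
      MvPolynomial.monomial (exponents s (s + 1) s (s + 1) 0 0)
        (1 / (s.factorial * (s + 1).factorial) : ℚ) := by
  rw [PowerSeries.coeff_C_mul, primAB, coeffwise, PowerSeries.coeff_mk, coeff_entryI0_a1_b1,
    primitive_monomial, sqrtY, MvPolynomial.X, MvPolynomial.monomial_mul]
  congr 1
  · congr 1
    ext i
    rcases i with (_ | _) | (_ | _ | _ | _) <;> simp [exponents, add_comm]
  · simp only [exponents, Finsupp.equivFunOnFinite_symm_apply_apply, Nat.factorial_succ]
    push_cast
    field_simp

theorem coeff_prim_a2 (s : ℕ) :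
    PowerSeries.coeff (2 * s)
        (PowerSeries.C (sqrtY Sgn.plus) * primAB AB.a2 (entryI0 AB.a2 AB.b2)) =
      MvPolynomial.monomial (exponents (s + 1) s 0 0 (s + 1) s)
        (1 / (s.factorial * (s + 1).factorial) : ℚ) := by
  rw [PowerSeries.coeff_C_mul, primAB, coeffwise, PowerSeries.coeff_mk, coeff_entryI0_a2_b2,
    primitive_monomial, sqrtY, MvPolynomial.X, MvPolynomial.monomial_mul]
  congr 1
  · congr 1
    ext i
    rcases i with (_ | _) | (_ | _ | _ | _) <;> simp [exponents, add_comm]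
  · simp only [exponents, Finsupp.equivFunOnFinite_symm_apply_apply, Nat.factorial_succ]
    push_cast
    field_simp

theorem coeff_mul_of_even {R : Type*} [CommRing R] {f g : R⟦X⟧}
    (hf : ∀ N, ¬Even N → PowerSeries.coeff N f = 0)
    (hg : ∀ N, ¬Even N → PowerSeries.coeff N g = 0) (K : ℕ) :
    PowerSeries.coeff (2 * K) (f * g) = ∑ p ∈ Finset.HasAntidiagonal.antidiagonal K,
      PowerSeries.coeff (2 * p.1) f * PowerSeries.coeff (2 * p.2) g := by
  rw [PowerSeries.coeff_mul]
  refine (Finset.sum_of_injOn (fun p : ℕ × ℕ => (2 * p.1, 2 * p.2)) ?_ ?_ ?_ fun _ _ => rfl).symm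
  · rintro ⟨a, b⟩ _ ⟨c, d⟩ _ h
    simp only [Prod.mk.injEq] at h ⊢
    omega
  · rintro ⟨a, b⟩ h
    simp only [Finset.mem_coe, Finset.HasAntidiagonal.mem_antidiagonal] at h ⊢
    omega
  · rintro ⟨a, b⟩ h hn
    by_cases ha : Even a
    · by_cases hb : Even b
      · obtain ⟨a, rfl⟩ := ha
        obtain ⟨b, rfl⟩ := hb
        simp only [Finset.HasAntidiagonal.mem_antidiagonal] at h
        refine absurd ⟨(a, b), ?_, ?_⟩ hn
        · simp only [Finset.mem_coe, Finset.HasAntidiagonal.mem_antidiagonal]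
          omega
        · simp only [two_mul]
      · simp only [hg b hb, mul_zero]
    · simp only [hf a ha, zero_mul]

theorem coeff_mul_of_not_even {R : Type*} [CommRing R] {f g : R⟦X⟧}
    (hf : ∀ N, ¬Even N → PowerSeries.coeff N f = 0)
    (hg : ∀ N, ¬Even N → PowerSeries.coeff N g = 0) {N : ℕ} (hN : ¬Even N) :
    PowerSeries.coeff N (f * g) = 0 := by
  rw [PowerSeries.coeff_mul]
  refine Finset.sum_eq_zero fun p hp => ?_
  rw [← Finset.HasAntidiagonal.mem_antidiagonal.1 hp] at hN
  by_cases ha : Even p.1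
  · rw [hg p.2 fun hb => hN (ha.add hb), mul_zero]
  · rw [hf p.1 ha, zero_mul]

theorem det_besselMatrix : besselMatrix.det = entryI0 AB.a1 AB.b1 * entryI0 AB.a2 AB.b2 -
    PowerSeries.X ^ 2 *
      ((PowerSeries.C (sqrtY Sgn.minus) * primAB AB.b1 (entryI0 AB.a1 AB.b1)) *
        (PowerSeries.C (sqrtY Sgn.plus) * primAB AB.a2 (entryI0 AB.a2 AB.b2))) := by
  rw [besselMatrix, Matrix.det_fin_two_of]
  ring

theorem coeff_det_of_not_even {N : ℕ} (hN : ¬Even N) :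
    PowerSeries.coeff N besselMatrix.det = 0 := by
  rw [det_besselMatrix, map_sub, coeff_mul_of_not_even (fun _ => coeff_entryI0_of_not_even _ _)
    (fun _ => coeff_entryI0_of_not_even _ _) hN, PowerSeries.coeff_X_pow_mul', zero_sub,
    neg_eq_zero]
  split_ifs with h
  · refine coeff_mul_of_not_even (fun _ => coeff_prim_of_not_even _ _ _ _)
      (fun _ => coeff_prim_of_not_even _ _ _ _) fun h' => hN ?_
    exact (Nat.even_sub h).1 h' |>.2 even_two
  · rfl

theorem coeff_det_zero :
    PowerSeries.coeff 0 besselMatrix.det = MvPolynomial.monomial (exponents 0 0 0 0 0 0) 1 := by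
  rw [det_besselMatrix, map_sub, PowerSeries.coeff_X_pow_mul', if_neg (by norm_num), sub_zero]
  have h := coeff_mul_of_even (f := entryI0 AB.a1 AB.b1) (g := entryI0 AB.a2 AB.b2)
    (fun _ => coeff_entryI0_of_not_even _ _) (fun _ => coeff_entryI0_of_not_even _ _) 0
  rw [mul_zero, Finset.HasAntidiagonal.antidiagonal_zero, Finset.sum_singleton,
    coeff_entryI0_a1_b1, coeff_entryI0_a2_b2, MvPolynomial.monomial_mul, exponents_add] at h
  simpa using h

theorem coeff_det_succ (L : ℕ) :
    PowerSeries.coeff (2 * (L + 1)) besselMatrix.det =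
      ∑ p ∈ Finset.HasAntidiagonal.antidiagonal (L + 1),
        MvPolynomial.monomial (exponents (L + 1) (L + 1) p.1 p.1 p.2 p.2)
          (1 / (p.1.factorial * p.1.factorial) * (1 / (p.2.factorial * p.2.factorial)) : ℚ) -
      ∑ p ∈ Finset.HasAntidiagonal.antidiagonal L,
        MvPolynomial.monomial (exponents (L + 1) (L + 1) p.1 (p.1 + 1) (p.2 + 1) p.2)
          (1 / (p.1.factorial * (p.1 + 1).factorial) *
            (1 / (p.2.factorial * (p.2 + 1).factorial)) : ℚ) := by
  rw [det_besselMatrix, map_sub, PowerSeries.coeff_X_pow_mul', if_pos (by omega),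
    show 2 * (L + 1) - 2 = 2 * L by omega,
    coeff_mul_of_even (fun _ => coeff_entryI0_of_not_even _ _)
      (fun _ => coeff_entryI0_of_not_even _ _),
    coeff_mul_of_even (fun _ => coeff_prim_of_not_even _ _ _ _)
      (fun _ => coeff_prim_of_not_even _ _ _ _)]
  congr 1
  · refine Finset.sum_congr rfl fun p hp => ?_
    rw [coeff_entryI0_a1_b1, coeff_entryI0_a2_b2, MvPolynomial.monomial_mul, exponents_add,
      ← Finset.HasAntidiagonal.mem_antidiagonal.1 hp]
    simp only [zero_add, add_zero]
  · refine Finset.sum_congr rfl fun p hp => ?_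
    rw [coeff_prim_b1, coeff_prim_a2, MvPolynomial.monomial_mul, exponents_add,
      ← Finset.HasAntidiagonal.mem_antidiagonal.1 hp]
    simp only [zero_add, add_zero, ← add_assoc, add_right_comm]

theorem coeffFunctional_exponents (K α β γ δ : ℕ) (c : ℚ) :
    coeffFunctional (MvPolynomial.monomial (exponents K K α β γ δ) c) = if Even K then
      c * (derivSum (K / 2) α γ / K.factorial) * (derivSum (K / 2) β δ / K.factorial) else 0 :=
  coeffFunctional_monomial rfl rfl

theorem coeffFunctional_det_of_not_even {K : ℕ} (hK : ¬Even K) :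
    coeffFunctional (PowerSeries.coeff (2 * K) besselMatrix.det) = 0 := by
  obtain _ | L := K
  · exact absurd Even.zero hK
  · rw [coeff_det_succ, map_sub, map_sum, map_sum]
    simp only [coeffFunctional_exponents, if_neg hK, Finset.sum_const_zero, sub_zero]

theorem coeffFunctional_det (n : ℕ) :
    coeffFunctional (PowerSeries.coeff (2 * (2 * n)) besselMatrix.det) =
      (trinomial (2 * n) 0 - trinomial (2 * n) 1) / ((2 * n).factorial : ℚ) ^ 2 := by
  obtain _ | n := n
  · rw [mul_zero, mul_zero, coeff_det_zero, coeffFunctional_exponents]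
    simp [derivSum, trinomial]
  · rw [show 2 * (n + 1) = 2 * n + 1 + 1 by ring, coeff_det_succ,
      show 2 * n + 1 + 1 = 2 * (n + 1) by ring, map_sub, map_sum, map_sum, ← sum_trinomial_sq,
      ← sum_trinomial_mul_succ, sub_div, Finset.sum_div, Finset.sum_div]
    simp only [coeffFunctional_exponents, if_pos (even_two_mul (n + 1)),
      Nat.mul_div_cancel_left _ two_pos]
    have p0 : ∀ s : ℕ, (s.factorial : ℚ) ≠ 0 := fun s => by positivity
    congr 1
    · refine Finset.sum_congr rfl fun p hp => ?_
      have h1 := p0 p.1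
      have h2 := p0 p.2
      rw [derivSum_eq (Finset.HasAntidiagonal.mem_antidiagonal.1 hp)]
      push_cast
      field_simp
    · refine Finset.sum_congr rfl fun p hp => ?_
      have hp := Finset.HasAntidiagonal.mem_antidiagonal.1 hp
      have h1 := p0 p.1
      have h2 := p0 p.2
      have h3 := p0 (p.1 + 1)
      have h4 := p0 (p.2 + 1)
      rw [derivSum_eq (show p.1 + (p.2 + 1) = 2 * (n + 1) by omega),
        derivSum_eq (show p.1 + 1 + p.2 = 2 * (n + 1) by omega)]
      push_cast
      field_simp

end PlanarMatching

theorem theorem8 :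
    (PowerSeries.mk fun N : ℕ =>
        if 4 ∣ N then
          (PlanarMatching.g 2 (N / 4) 2 : ℚ) / (((2 * (N / 4)).factorial : ℚ) ^ 2)
        else 0) =
      PlanarMatching.D
        (PlanarMatching.coeffwise PlanarMatching.integralPart
          PlanarMatching.besselMatrix.det) := by
  ext N
  have e : PowerSeries.coeff N (PlanarMatching.D
      (PlanarMatching.coeffwise PlanarMatching.integralPart PlanarMatching.besselMatrix.det)) =
      PlanarMatching.coeffFunctional (PowerSeries.coeff N PlanarMatching.besselMatrix.det) := by
    rw [PlanarMatching.D, PlanarMatching.coeffwise, PlanarMatching.coeffwise,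
      PowerSeries.coeff_mk, PowerSeries.coeff_mk]
    rfl
  rw [e, PowerSeries.coeff_mk]
  by_cases h2 : Even N
  · obtain ⟨K, rfl⟩ := h2.exists_two_nsmul
    rw [smul_eq_mul]
    by_cases hK : Even K
    · obtain ⟨n, rfl⟩ := hK.exists_two_nsmul
      have g2 := PlanarMatching.g_two_two n
      rw [smul_eq_mul, PlanarMatching.coeffFunctional_det, if_pos (by omega),
        show 2 * (2 * n) / 4 = n by omega]
      congr 1
      exact_mod_cast g2
    · rw [PlanarMatching.coeffFunctional_det_of_not_even hK, if_neg]
      rw [Nat.even_iff] at hK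
      omega
  · rw [PlanarMatching.coeff_det_of_not_even h2, map_zero, if_neg]
    rw [Nat.even_iff] at h2
    omega
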